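/- All polygons are simple polygons in the Euclidean plane, regarded as closed regions. A triangulation of a polygon $P$ is a subdivision of $P$ into triangles that meet face to face, whose vertices are exactly the vertices of $P$. A flip removes an edge $ac$ shared by two triangles $abc$, $acd$ whose union is a strictly convex quadrilateral $abcd$, and inserts the other diagonal $bd$. The flip distance of two triangulations of $P$ is the minimum number of flips that transform one into the other. A double chain consists of an upper chain $\langle u_1,\dots,u_n\rangle$ and a lower chain $\langle l_1,\dots,l_n\rangle$ such that $P_D=\langle l_1,\dots,l_n,u_n,\dots,u_1\rangle$ is a simple polygon, every vertex of one chain sees every vertex of the other chain inside $P_D$ (the segment between them lies in $P_D$), and any three vertices of one chain together with one vertex of the other chain form a non-convex quadrilateral, whose reflex corner is the middle one of the three chain vertices (that is, this vertex lies in the interior of the triangle spanned by the other three). The upper (respectively lower) extreme triangulation of $P_D$ is the triangulation of $P_D$ in which $u_1$ (respectively $l_1$) has the maximum degree among all triangulations of $P_D$. **Lemma.** Let $n\ge 5$, and let $u_1,\dots,u_n$ and $l_1,\dots,l_n$ form a double chain. Let $P$ be a simple polygon that contains $P_D$ and has the paths $\langle l_1,\dots,l_n\rangle$ and $\langle u_n,\dots,u_1\rangle$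 as part of its boundary. Let $T_1$ and $T_2$ be triangulations of $P$ that contain the upper extreme triangulation and the lower extreme triangulation of $P_D$, respectively, as a sub-triangulation. Then the flip distance of $T_1$ and $T_2$ is at least $4n-4$. -/

import Mathlib

open Geometry

namespace PolyFlip

/-- The Euclidean plane. -/
abbrev Plane : Type := EuclideanSpace ℝ (Fin 2)

/-- The vertices are distinct, and two different edges meet exactly in their common end points
(so edges that are not consecutive are disjoint). -/
structure IsSimple {m : ℕ} (P : Polygon Plane m) : Prop where
  three_le : 3 ≤ m
  injective : Function.Injective P.vertices
  edge_inter : ∀ i j : Fin m, i ≠ j →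
    P.edgeSet ℝ i ∩ P.edgeSet ℝ j =
      {P i, P (finRotate m i)} ∩ {P j, P (finRotate m j)}

/-- The closed region bounded by a polygon: its boundary together with all bounded connected
components of the complement of the boundary. -/
def region {m : ℕ} (P : Polygon Plane m) : Set Plane :=
  P.boundary ℝ ∪
    {x | x ∉ P.boundary ℝ ∧
      Bornology.IsBounded (connectedComponentIn (P.boundary ℝ)ᶜ x)}

/-- A triangulation of a polygon: a geometric simplicial complex that fills the closed region and
whose vertices are exactly the vertices of the polygon. -/
structure IsTriangulation {m : ℕ} (P : Polygon Plane m) (K : SimplicialComplex ℝ Plane) :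
    Prop where
  space_eq : K.space = region P
  vertices_eq : K.vertices = Set.range P.vertices

/-- The triangulations of a polygon. -/
abbrev Triangulation {m : ℕ} (P : Polygon Plane m) : Type :=
  {K : SimplicialComplex ℝ Plane // IsTriangulation P K}

/-- The points `a, b, c, d`, in this cyclic order, are the corners of a strictly convex
quadrilateral: they are in convex position and `ac`, `bd` are the diagonals. -/
def IsConvexQuad (a b c d : Plane) : Prop :=
  ConvexIndependent ℝ ![a, b, c, d] ∧ (openSegment ℝ a c ∩ openSegment ℝ b d).Nonempty

open Classical in
/-- `K'` arises from `K` by one flip: the triangles `abc` and `acd` of `K` form a convex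
quadrilateral `abcd`, and its diagonal `ac` is replaced by its diagonal `bd`. -/
def IsFlip (K K' : SimplicialComplex ℝ Plane) : Prop :=
  ∃ a b c d : Plane, IsConvexQuad a b c d ∧
    {a, b, c} ∈ K.faces ∧ {a, c, d} ∈ K.faces ∧
    K'.faces = (K.faces \ {{a, b, c}, {a, c, d}, {a, c}}) ∪ {{a, b, d}, {b, c, d}, {b, d}}

/-- The flip graph of a polygon. -/
def flipGraph {m : ℕ} (P : Polygon Plane m) : SimpleGraph (Triangulation P) :=
  SimpleGraph.fromRel fun T T' => IsFlip T.1 T'.1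

/-- The flip distance: the least number of flips that lead from `T` to `T'` through triangulations
of `P` (it would be `⊤` if there were no flip sequence). -/
noncomputable def flipDist {m : ℕ} {P : Polygon Plane m} (T T' : Triangulation P) : ℕ∞ :=
  (flipGraph P).edist T T'

open Classical in
/-- The number of edges of a triangulation at the point `p`. -/
noncomputable def degree (K : SimplicialComplex ℝ Plane) (p : Plane) : ℕ :=
  {q : Plane | q ≠ p ∧ {p, q} ∈ K.faces}.ncard

/-- A triangulation of `P` in which `p` has the maximum degree, among all triangulations of `P`. -/
def IsMaxDegreeTriangulation {m : ℕ} (P : Polygon Plane m) (p : Plane)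
    (K : SimplicialComplex ℝ Plane) : Prop :=
  IsTriangulation P K ∧ ∀ K', IsTriangulation P K' → degree K' p ≤ degree K p

/-- The polygon `⟨l₁, …, lₙ, uₙ, …, u₁⟩` (chains are indexed from `0` here). -/
def doubleChainPolygon {n : ℕ} (u l : Fin n → Plane) : Polygon Plane (n + n) :=
  ⟨Fin.append l fun i => u i.rev⟩

/-- A double chain with upper chain `u` and lower chain `l`. The points of one chain see the points
of the other chain inside the polygon. Three vertices of one chain and one vertex of the other chain
form a non-convex quadrilateral; its reflex corner, which lies in the interior of the triangle
of the other three corners, is the middle one of the three chain vertices. -/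
structure IsDoubleChain {n : ℕ} (u l : Fin n → Plane) : Prop where
  simple : IsSimple (doubleChainPolygon u l)
  sees : ∀ i j, segment ℝ (u i) (l j) ⊆ region (doubleChainPolygon u l)
  upper_nonconvex : ∀ a b c k : Fin n, a < b → b < c →
    u b ∈ interior (convexHull ℝ {u a, u c, l k})
  lower_nonconvex : ∀ a b c k : Fin n, a < b → b < c →
    l b ∈ interior (convexHull ℝ {l a, l c, u k})

/-- The path `c` is part of the boundary of `P`: any two consecutive points of `c` are the two ends
of an edge of `P`. -/
def IsBoundaryPath {n m : ℕ} (c : Fin n → Plane) (P : Polygon Plane m) : Prop :=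
  ∀ i j : Fin n, (i : ℕ) + 1 = j → ∃ k : Fin m, s(P k, P (finRotate m k)) = s(c i, c j)

end PolyFlip

/-!
The lower bound comes from following, along a sequence of flips, the triangles at the edges of the
two chains.

An edge of a chain is an edge of `P`, so it is never flipped away: a flip of it would need a
neighbourhood of its midpoint inside the region of `P`, but every boundary point of a simple polygon
is a limit of points outside of the region (`IsSimple.boundary_subset_closure`, the part of the
Jordan curve theorem that is needed here: one can walk along the edges and around the vertices,
close to the boundary, without leaving a component of the complement). Hence in each
triangulation on the way every chain edge has a unique triangle on its inner side, and its apex is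
not on the same chain.

In the upper extreme triangulation the apices of the edges of the upper chain are at `l (n - 1)`,
and those of the edges of the lower chain at `u 0`; in the lower extreme triangulation they are at
`l 0` and `u (n - 1)`. This holds since the fan that joins `u 0` to all points of the lower chain
and `l (n - 1)` to all points of the upper chain is a triangulation of the double chain polygon
(`fanComplex`, `ChainPair.region_eq_fanSpace`). It gives `u 0` every neighbour that it can have, so
a triangulation with maximum degree at `u 0` has the edge from `u 0` to `l (n - 1)`, which
determines the triangles at all chain edges (`ChainPair.faces_of_isMaxDegree`).

Give the apex of an edge the value `min k 4` if it is the point `k` of the opposite chain (for the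
lower chain, `4 - min k 4`), and `2` if it is not on that chain. As `5 ≤ n`, the sum of these values
over the `2 * (n - 1)` chain edges is `8 * (n - 1)` at the start and `0` at the end. A flip that
changes the apices of two chain edges has these two edges as opposite sides of its quadrilateral,
and moves both apices to neighbouring points of the opposite chains, because the points of a chain
are reflex; so it changes two values by at most `1`. Any other flip changes at most one value, by at
most `2` (`IsSwap.exists_isApexMap`). So at least `4 * (n - 1)` flips are needed.
-/

namespace PolyFlip

open Set Filter Topology

/-! ### Orientation of triples of points -/

/-- Twice the signed area of the triangle `p q r`: positive if the triangle is oriented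
counterclockwise. -/
def orient (p q r : Plane) : ℝ :=
  (q 0 - p 0) * (r 1 - p 1) - (q 1 - p 1) * (r 0 - p 0)

theorem plane_ext {x y : Plane} (h0 : x 0 = y 0) (h1 : x 1 = y 1) : x = y := by
  ext i
  fin_cases i
  · exact h0
  · exact h1

theorem orient_rotate (p q r : Plane) : orient q r p = orient p q r := by
  simp only [orient]; ring

theorem orient_swap_left (p q r : Plane) : orient q p r = -orient p q r := by
  simp only [orient]; ring

theorem orient_swap_right (p q r : Plane) : orient p r q = -orient p q r := by
  simp only [orient]; ring

@[simp] theorem orient_self_left (p r : Plane) : orient p p r = 0 := by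
  simp only [orient]; ring

@[simp] theorem orient_self_right (p q : Plane) : orient p q q = 0 := by
  simp only [orient]; ring

@[simp] theorem orient_self_outer (p q : Plane) : orient p q p = 0 := by
  simp only [orient]; ring

theorem orient_combo {a b : ℝ} (hab : a + b = 1) (p q x y : Plane) :
    orient p q (a • x + b • y) = a * orient p q x + b * orient p q y := by
  obtain rfl : b = 1 - a := by linarith
  simp only [orient, PiLp.add_apply, PiLp.smul_apply, smul_eq_mul]
  ring

@[fun_prop]
theorem continuous_orient (p q : Plane) : Continuous (orient p q) := by
  unfold orient
  fun_prop

/-- The barycentric coordinates of `x` with respect to the triangle `p q r`. -/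
theorem orient_smul_eq (p q r x : Plane) :
    orient p q r • x = orient q r x • p + orient r p x • q + orient p q x • r := by
  apply plane_ext <;>
    · simp only [orient, PiLp.add_apply, PiLp.smul_apply, smul_eq_mul]
      ring

theorem convex_orient_nonneg (k : ℝ) (p q : Plane) : Convex ℝ {x | 0 ≤ k * orient p q x} := by
  intro x hx y hy a b ha hb hab
  simp only [mem_ofPred_eq] at *
  rw [orient_combo hab]
  have := mul_nonneg ha hx
  have := mul_nonneg hb hy
  nlinarith

theorem convex_orient_pos (k : ℝ) (p q : Plane) : Convex ℝ {x | 0 < k * orient p q x} := by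
  intro x hx y hy a b ha hb hab
  simp only [mem_ofPred_eq] at *
  rw [orient_combo hab]
  have h1 := mul_nonneg ha hx.le
  have h2 := mul_nonneg hb hy.le
  rcases ha.lt_or_eq with ha | ha
  · nlinarith [mul_pos ha hx]
  · have : b = 1 := by linarith
    subst this
    nlinarith

theorem orient_nonneg_of_mem_convexHull {k : ℝ} {p q x : Plane} {s : Set Plane}
    (h : ∀ y ∈ s, 0 ≤ k * orient p q y) (hx : x ∈ convexHull ℝ s) : 0 ≤ k * orient p q x :=
  convexHull_min (fun y hy => h y hy) (convex_orient_nonneg k p q) hx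

/-- If a line supports `s`, then it meets the convex hull of `s` in the convex hull of the points
of `s` on the line. -/
theorem mem_convexHull_of_orient_eq_zero {k : ℝ} {p q x : Plane} {s : Finset Plane}
    (h : ∀ y ∈ s, 0 ≤ k * orient p q y) (hx : x ∈ convexHull ℝ (s : Set Plane))
    (hx0 : k * orient p q x = 0) :
    x ∈ convexHull ℝ {y | y ∈ s ∧ k * orient p q y = 0} := by
  classical
  rw [Finset.convexHull_eq] at hx
  obtain ⟨w, hw0, hw1, rfl⟩ := hx
  rw [Finset.centerMass_eq_of_sum_1 _ _ hw1] at hx0 ⊢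
  have key : ∀ t : Finset Plane, ∀ v : Plane → ℝ,
      orient p q (∑ y ∈ t, v y • y) - orient p q 0 = ∑ y ∈ t, v y * (orient p q y - orient p q 0) := by
    intro t v
    induction t using Finset.induction_on with
    | empty => simp
    | insert a t ha ih =>
      rw [Finset.sum_insert ha, Finset.sum_insert ha, ← ih]
      simp only [orient, PiLp.add_apply, PiLp.smul_apply, smul_eq_mul, PiLp.zero_apply]
      ring
  have hsum : ∑ y ∈ s, w y * (k * orient p q y) = 0 := by
    have := key s w
    simp only [id] at hx0
    have h2 : ∑ y ∈ s, w y * (orient p q y - orient p q 0) =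
        ∑ y ∈ s, w y * orient p q y - orient p q 0 := by
      simp only [mul_sub, Finset.sum_sub_distrib, ← Finset.sum_mul, hw1, one_mul]
    have h3 : ∑ y ∈ s, w y * (k * orient p q y) = k * ∑ y ∈ s, w y * orient p q y := by
      rw [Finset.mul_sum]
      exact Finset.sum_congr rfl fun y _ => by ring
    rw [h3, ← hx0]
    congr 1
    linarith
  have hz := (Finset.sum_eq_zero_iff_of_nonneg fun y hy => mul_nonneg (hw0 y hy) (h y hy)).1 hsum
  have hs : ∑ y ∈ s.filter (fun y => k * orient p q y = 0), w y • id y = ∑ y ∈ s, w y • id y := by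
    refine Finset.sum_filter_of_ne fun y hy hne => ?_
    rcases mul_eq_zero.1 (hz y hy) with h0 | h0
    · simp [h0] at hne
    · exact h0
  have hs1 : ∑ y ∈ s.filter (fun y => k * orient p q y = 0), w y = 1 := by
    rw [← hw1]
    refine Finset.sum_filter_of_ne fun y hy hne => ?_
    rcases mul_eq_zero.1 (hz y hy) with h0 | h0
    · exact absurd h0 hne
    · exact h0
  rw [← hs]
  refine (convex_convexHull ℝ _).sum_mem (fun y hy => hw0 y (Finset.mem_filter.1 hy).1) hs1
    fun y hy => subset_convexHull ℝ _ ?_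
  exact Finset.mem_filter.1 hy

/-- A triangle is the intersection of three half-planes. -/
theorem mem_triangle_iff {k : ℝ} {p q r x : Plane} (h : 0 < k * orient p q r) :
    x ∈ convexHull ℝ ({p, q, r} : Set Plane) ↔
      0 ≤ k * orient p q x ∧ 0 ≤ k * orient q r x ∧ 0 ≤ k * orient r p x := by
  constructor
  · intro hx
    have h1 : orient q r p = orient p q r := orient_rotate p q r
    have h2 : orient r p q = orient p q r := by rw [orient_rotate, orient_rotate]
    refine ⟨orient_nonneg_of_mem_convexHull ?_ hx, orient_nonneg_of_mem_convexHull ?_ hx,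
      orient_nonneg_of_mem_convexHull ?_ hx⟩ <;> simp [h1, h2, h.le]
  · rintro ⟨h1, h2, h3⟩
    have hsum : orient q r x + orient r p x + orient p q x = orient p q r := by
      simp only [orient]; ring
    have hD : orient p q r ≠ 0 := fun h0 => by simp [h0] at h
    have hx : x = ∑ i : Fin 3, (![k * orient q r x, k * orient r p x, k * orient p q x] i /
        (k * orient p q r)) • ![p, q, r] i := by
      have := orient_smul_eq p q r x
      have hk : k ≠ 0 := fun h0 => by simp [h0] at h
      simp only [Fin.sum_univ_three, Matrix.cons_val_zero, Matrix.cons_val_one, Matrix.cons_val]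
      rw [mul_div_mul_left _ _ hk, mul_div_mul_left _ _ hk, mul_div_mul_left _ _ hk]
      rw [div_eq_inv_mul, div_eq_inv_mul, div_eq_inv_mul, mul_smul, mul_smul, mul_smul,
        ← smul_add, ← smul_add, ← this, smul_smul, inv_mul_cancel₀ hD, one_smul]
    rw [hx]
    refine (convex_convexHull ℝ _).sum_mem ?_ ?_ ?_
    · intro i _
      fin_cases i
      · exact div_nonneg h2 h.le
      · exact div_nonneg h3 h.le
      · exact div_nonneg h1 h.le
    · simp only [Fin.sum_univ_three, Matrix.cons_val_zero, Matrix.cons_val_one, Matrix.cons_val]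
      rw [← add_div, ← add_div, ← mul_add, ← mul_add, hsum, div_self h.ne']
    · intro i _
      apply subset_convexHull
      fin_cases i <;> simp

/-- A normal vector of the line `p q` that points to its left side. -/
theorem exists_normal (p q : Plane) : ∃ v : Plane, ∀ x : Plane, ∀ t : ℝ,
    orient p q (x + t • v) = orient p q x + t * dist p q ^ 2 := by
  refine ⟨!₂[-(q 1 - p 1), q 0 - p 0], fun x t => ?_⟩
  rw [EuclideanSpace.dist_eq, Real.sq_sqrt (by positivity)]
  simp only [orient, PiLp.add_apply, PiLp.smul_apply, smul_eq_mul, Fin.sum_univ_two,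
    Real.dist_eq, sq_abs]
  simp
  ring

/-- A line that supports a set does not meet its interior. -/
theorem orient_pos_of_mem_interior {k : ℝ} (hk : k ≠ 0) {p q x : Plane} (hpq : p ≠ q)
    {s : Set Plane} (hx : x ∈ interior s) (h : ∀ y ∈ s, 0 ≤ k * orient p q y) :
    0 < k * orient p q x := by
  refine lt_of_le_of_ne (h x (interior_subset hx)) fun h0 => ?_
  obtain ⟨v, hv⟩ := exists_normal p q
  have hc : Continuous fun t : ℝ => x + t • (-(k • v)) := by fun_prop
  have hmem : ∀ᶠ t in 𝓝 (0 : ℝ), x + t • (-(k • v)) ∈ s :=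
    hc.continuousAt.eventually_mem (by simpa using mem_interior_iff_mem_nhds.1 hx)
  obtain ⟨t, ht, ht0⟩ := ((hmem.filter_mono nhdsWithin_le_nhds).and
    (self_mem_nhdsWithin (s := Ioi (0 : ℝ)))).exists
  have := h _ ht
  rw [← neg_smul, smul_smul, hv, mul_add, ← h0] at this
  have hd : 0 < dist p q := dist_pos.2 hpq
  have ht0 : 0 < t := ht0
  have : 0 < t * (k ^ 2 * dist p q ^ 2) := by positivity
  nlinarith

theorem orient_ne_zero_of_mem_interior_triangle {p q r x : Plane}
    (hx : x ∈ interior (convexHull ℝ ({p, q, r} : Set Plane))) : orient p q r ≠ 0 := by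
  intro h0
  -- all three corners lie on one line `a b`
  obtain ⟨a, b, hab, hs⟩ : ∃ a b : Plane, a ≠ b ∧ ∀ y ∈ ({p, q, r} : Set Plane),
      orient a b y = 0 := by
    by_cases hpq : p = q
    · by_cases hpr : p = r
      · refine ⟨p, p + EuclideanSpace.single 0 1, ?_, ?_⟩
        · intro h
          have := congrArg (fun z : Plane => z 0) h
          simp at this
        · simp [← hpq, ← hpr]
      · exact ⟨p, r, hpr, by simp [← hpq]⟩
    · exact ⟨p, q, hpq, by simp [h0]⟩
  have h1 := orient_pos_of_mem_interior one_ne_zero hab hx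
    fun y hy => orient_nonneg_of_mem_convexHull (fun z hz => by rw [hs z hz, mul_zero]) hy
  have h2 := orient_pos_of_mem_interior (neg_ne_zero.2 one_ne_zero) hab hx
    fun y hy => orient_nonneg_of_mem_convexHull (fun z hz => by rw [hs z hz, mul_zero]) hy
  linarith

/-- An interior point of a triangle sees all sides in the orientation of the triangle. -/
theorem orient_of_mem_interior_triangle {p q r x : Plane}
    (hx : x ∈ interior (convexHull ℝ ({p, q, r} : Set Plane))) :
    0 < orient p q r * orient p q x ∧ 0 < orient p q r * orient q r x ∧
      0 < orient p q r * orient r p x := by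
  have hD := orient_ne_zero_of_mem_interior_triangle hx
  have h1 : orient q r p = orient p q r := orient_rotate p q r
  have h2 : orient r p q = orient p q r := by rw [orient_rotate, orient_rotate]
  have hpos : 0 < orient p q r * orient p q r := mul_self_pos.2 hD
  have hpq : p ≠ q := by rintro rfl; simp at hD
  have hqr : q ≠ r := by rintro rfl; simp at hD
  have hrp : r ≠ p := by rintro rfl; simp at hD
  exact ⟨orient_pos_of_mem_interior hD hpq hx fun y hy => ((mem_triangle_iff hpos).1 hy).1,
    orient_pos_of_mem_interior hD hqr hx fun y hy => ((mem_triangle_iff hpos).1 hy).2.1,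
    orient_pos_of_mem_interior hD hrp hx fun y hy => ((mem_triangle_iff hpos).1 hy).2.2⟩

/-- Two segments meet if each separates the end points of the other strictly. -/
theorem segments_inter_nonempty {a b c d : Plane} (h1 : orient a b c * orient a b d < 0)
    (h2 : orient c d a * orient c d b < 0) : (segment ℝ a b ∩ segment ℝ c d).Nonempty := by
  have hE : orient c d a - orient c d b = orient a b d - orient a b c := by
    simp only [orient]; ring
  have hE0 : orient a b d - orient a b c ≠ 0 := by
    intro h
    have : orient a b d = orient a b c := by linarith
    rw [this] at h1
    nlinarith [mul_self_nonneg (orient a b c)]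
  have hs : ∀ x y : ℝ, x * y < 0 → 0 ≤ x / (x - y) ∧ x / (x - y) ≤ 1 := by
    intro x y hxy
    rcases mul_neg_iff.1 hxy with ⟨hx, hy⟩ | ⟨hx, hy⟩
    · exact ⟨div_nonneg hx.le (by linarith), (div_le_one (by linarith)).2 (by linarith)⟩
    · refine ⟨div_nonneg_of_nonpos hx.le (by linarith), ?_⟩
      rw [div_le_one_of_neg (by linarith)]
      linarith
  obtain ⟨hs0, hs1⟩ := hs _ _ h2
  obtain ⟨ht0, ht1⟩ := hs _ _ h1
  refine ⟨AffineMap.lineMap a b (orient c d a / (orient c d a - orient c d b)), ?_, ?_⟩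
  · rw [segment_eq_image_lineMap]
    exact ⟨_, ⟨hs0, hs1⟩, rfl⟩
  · rw [segment_eq_image_lineMap]
    refine ⟨_, ⟨ht0, ht1⟩, ?_⟩
    have e : orient a b c - orient a b d = -(orient a b d - orient a b c) := by ring
    rw [hE, e]
    apply plane_ext <;>
      · simp only [AffineMap.lineMap_apply_module', PiLp.add_apply, PiLp.smul_apply,
          PiLp.sub_apply, smul_eq_mul]
        field_simp
        simp only [orient]
        ring

theorem orient_openSegment {p q x : Plane} (hx : x ∈ openSegment ℝ p q) (a b : Plane) :
    ∃ t : ℝ, 0 < t ∧ t < 1 ∧ orient a b x = (1 - t) * orient a b p + t * orient a b q := by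
  obtain ⟨s, t, hs, ht, hst, rfl⟩ := hx
  exact ⟨t, ht, by linarith, by rw [orient_combo hst]; congr 2; linarith⟩

theorem midpoint_mem_openSegment (p q : Plane) : midpoint ℝ p q ∈ openSegment ℝ p q :=
  ⟨1 / 2, 1 / 2, by norm_num, by norm_num, by norm_num, by
    rw [midpoint_eq_smul_add, smul_add, invOf_eq_inv, one_div]⟩

theorem orient_eq_zero_of_mem_segment {p q x : Plane} (hx : x ∈ segment ℝ p q) :
    orient p q x = 0 := by
  obtain ⟨s, t, hs, ht, hst, rfl⟩ := hx
  rw [orient_combo hst]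
  simp

/-- Near an inner point of the side `p q`, the triangle `p q r` fills the side of the line `p q`
that contains `r`. -/
theorem eventually_mem_triangle {k : ℝ} {p q r z : Plane} (h : 0 < k * orient p q r)
    (hz : z ∈ openSegment ℝ p q) :
    ∀ᶠ y in 𝓝 z, 0 ≤ k * orient p q y → y ∈ convexHull ℝ ({p, q, r} : Set Plane) := by
  have h1 : orient q r p = orient p q r := orient_rotate p q r
  have h2 : orient r p q = orient p q r := by rw [orient_rotate, orient_rotate]
  have a1 : 0 < k * orient q r z := by
    obtain ⟨t, ht0, ht1, e⟩ := orient_openSegment hz q r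
    rw [e, h1, orient_self_outer]
    have := mul_pos (sub_pos.2 ht1) h
    nlinarith
  have a2 : 0 < k * orient r p z := by
    obtain ⟨t, ht0, ht1, e⟩ := orient_openSegment hz r p
    rw [e, h2, orient_self_right]
    have := mul_pos ht0 h
    nlinarith
  have c1 : Continuous fun y => k * orient q r y := by fun_prop
  have c2 : Continuous fun y => k * orient r p y := by fun_prop
  filter_upwards [c1.continuousAt.eventually (lt_mem_nhds a1),
    c2.continuousAt.eventually (lt_mem_nhds a2)] with y hy1 hy2 hy
  exact (mem_triangle_iff h).2 ⟨hy, hy1.le, hy2.le⟩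

theorem mem_segment_of_mem_triangle {k : ℝ} {p q r x : Plane} (h : 0 < k * orient p q r)
    (hx : x ∈ convexHull ℝ ({p, q, r} : Set Plane)) (h0 : k * orient p q x = 0) :
    x ∈ segment ℝ p q := by
  classical
  have := mem_convexHull_of_orient_eq_zero (k := k) (p := p) (q := q) (s := {p, q, r})
    (by simp [h.le]) (by simpa using hx) h0
  rw [← convexHull_pair]
  refine convexHull_mono ?_ this
  rintro y ⟨hy, hy0⟩
  simp only [Finset.mem_insert, Finset.mem_singleton] at hy
  rcases hy with rfl | rfl | rfl
  · simp
  · simp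
  · exact absurd hy0 h.ne'

/-! ### The boundary of a simple polygon is approached from every complementary component -/

/-- `U` is a union of connected components of the complement of `B`. -/
structure IsComponentUnion (B U : Set Plane) : Prop where
  subset_compl : U ⊆ Bᶜ
  of_inter : ∀ S : Set Plane, IsPreconnected S → S ⊆ Bᶜ → (S ∩ U).Nonempty → S ⊆ U

theorem edgeSet_eq_segment {m : ℕ} (P : Polygon Plane m) (i : Fin m) :
    P.edgeSet ℝ i = segment ℝ (P i) (P (finRotate m i)) :=
  affineSegment_eq_segment _ _ _

theorem isCompact_edgeSet {m : ℕ} (P : Polygon Plane m) (i : Fin m) :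
    IsCompact (P.edgeSet ℝ i) := by
  rw [edgeSet_eq_segment, segment_eq_image_lineMap]
  exact isCompact_Icc.image AffineMap.lineMap_continuous

theorem isCompact_boundary {m : ℕ} (P : Polygon Plane m) : IsCompact (P.boundary ℝ) :=
  isCompact_iUnion fun i => isCompact_edgeSet P i

theorem edgeSet_subset_boundary {m : ℕ} (P : Polygon Plane m) (i : Fin m) :
    P.edgeSet ℝ i ⊆ P.boundary ℝ :=
  subset_iUnion (fun i => P.edgeSet ℝ i) i

theorem vertex_mem_edgeSet {m : ℕ} (P : Polygon Plane m) (i : Fin m) : P i ∈ P.edgeSet ℝ i := by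
  rw [edgeSet_eq_segment]; exact left_mem_segment _ _ _

theorem vertex_mem_edgeSet' {m : ℕ} (P : Polygon Plane m) (i : Fin m) :
    P (finRotate m i) ∈ P.edgeSet ℝ i := by
  rw [edgeSet_eq_segment]; exact right_mem_segment _ _ _

theorem finRotate_ne_self {m : ℕ} (hm : 2 ≤ m) (i : Fin m) : finRotate m i ≠ i := by
  obtain ⟨k, rfl⟩ : ∃ k, m = k + 2 := ⟨m - 2, by omega⟩
  rw [finRotate_apply]
  simp

theorem IsSimple.ne {m : ℕ} {P : Polygon Plane m} (hP : IsSimple P) (i : Fin m) :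
    P i ≠ P (finRotate m i) := fun h =>
  finRotate_ne_self (by have := hP.three_le; omega) i (hP.injective h).symm

theorem IsSimple.openSegment_disjoint {m : ℕ} {P : Polygon Plane m} (hP : IsSimple P)
    {i j : Fin m} (hij : i ≠ j) {x : Plane}
    (hx : x ∈ openSegment ℝ (P i) (P (finRotate m i))) : x ∉ P.edgeSet ℝ j := by
  intro hj
  have hxi : x ∈ P.edgeSet ℝ i := by
    rw [edgeSet_eq_segment]; exact openSegment_subset_segment _ _ _ hx
  have := (hP.edge_inter i j hij).subset ⟨hxi, hj⟩
  rcases this.1 with h | h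
  · rw [h, left_mem_openSegment_iff] at hx
    exact hP.ne i hx
  · rw [h, right_mem_openSegment_iff] at hx
    exact hP.ne i hx

/-- Two inner points of an edge have a common convex neighbourhood in which the boundary of the
polygon coincides with the line through this edge. -/
theorem IsSimple.exists_nhds_edge {m : ℕ} {P : Polygon Plane m} (hP : IsSimple P) (i : Fin m)
    {z z' : Plane} (hz : z ∈ openSegment ℝ (P i) (P (finRotate m i)))
    (hz' : z' ∈ openSegment ℝ (P i) (P (finRotate m i))) :
    ∃ W : Set Plane, IsOpen W ∧ Convex ℝ W ∧ z ∈ W ∧ z' ∈ W ∧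
      ∀ y ∈ W, y ∈ P.boundary ℝ ↔ orient (P i) (P (finRotate m i)) y = 0 := by
  set p := P i
  set q := P (finRotate m i)
  have hpq : p ≠ q := hP.ne i
  have hM : segment ℝ z z' ⊆ openSegment ℝ p q := (convex_openSegment p q).segment_subset hz hz'
  have hMc : IsCompact (segment ℝ z z') := by
    rw [segment_eq_image_lineMap]
    exact isCompact_Icc.image AffineMap.lineMap_continuous
  -- the union of the other edges
  have hN : IsClosed (⋃ j : {j : Fin m // j ≠ i}, P.edgeSet ℝ j) :=
    isClosed_iUnion_of_finite fun j => (isCompact_edgeSet P j).isClosed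
  have hMN : segment ℝ z z' ⊆ (⋃ j : {j : Fin m // j ≠ i}, P.edgeSet ℝ j)ᶜ := by
    intro x hx hxN
    obtain ⟨j, hj⟩ := mem_iUnion.1 hxN
    exact hP.openSegment_disjoint (Ne.symm j.2) (hM hx) hj
  obtain ⟨δ, hδ, hδN⟩ := hMc.exists_thickening_subset_open hN.isOpen_compl hMN
  -- the coordinate along the edge
  let τ : Plane → ℝ := fun y => (q 0 - p 0) * (y 0 - p 0) + (q 1 - p 1) * (y 1 - p 1)
  have hτc : Continuous τ := by fun_prop
  have hτ : ∀ a b : ℝ, a + b = 1 → ∀ x y, τ (a • x + b • y) = a * τ x + b * τ y := by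
    intro a b hab x y
    obtain rfl : b = 1 - a := by linarith
    simp only [τ, PiLp.add_apply, PiLp.smul_apply, smul_eq_mul]
    ring
  have hτp : τ p = 0 := by simp [τ]
  have hτq : 0 < τ q := by
    have : τ q = (q 0 - p 0) ^ 2 + (q 1 - p 1) ^ 2 := by simp only [τ]; ring
    rw [this]
    by_contra! h
    have h0 : q 0 - p 0 = 0 := by nlinarith [sq_nonneg (q 0 - p 0), sq_nonneg (q 1 - p 1)]
    have h1 : q 1 - p 1 = 0 := by nlinarith [sq_nonneg (q 0 - p 0), sq_nonneg (q 1 - p 1)]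
    exact hpq (plane_ext (by linarith) (by linarith))
  have hτo : ∀ x ∈ openSegment ℝ p q, 0 < τ x ∧ τ x < τ q := by
    rintro x ⟨a, b, ha, hb, hab, rfl⟩
    rw [hτ a b hab, hτp]
    constructor <;> nlinarith [mul_pos ha hτq, mul_pos hb hτq]
  refine ⟨Metric.thickening δ (segment ℝ z z') ∩ {y | 0 < τ y ∧ τ y < τ q}, ?_, ?_, ?_, ?_, ?_⟩
  · exact Metric.isOpen_thickening.inter
      ((isOpen_lt continuous_const hτc).inter (isOpen_lt hτc continuous_const))
  · refine ((convex_segment z z').thickening δ).inter ?_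
    rintro x ⟨hx0, hx1⟩ y ⟨hy0, hy1⟩ a b ha hb hab
    change 0 < τ (a • x + b • y) ∧ τ (a • x + b • y) < τ q
    rw [hτ a b hab]
    rcases ha.lt_or_eq with ha | ha
    · constructor <;> nlinarith [mul_pos ha hx0, mul_nonneg hb hy0.le,
        mul_pos ha (sub_pos.2 hx1), mul_nonneg hb (sub_pos.2 hy1).le]
    · obtain rfl : b = 1 := by linarith
      simp [← ha, hy0, hy1]
  · exact ⟨Metric.self_subset_thickening hδ _ (left_mem_segment _ _ _), hτo _ hz⟩
  · exact ⟨Metric.self_subset_thickening hδ _ (right_mem_segment _ _ _), hτo _ hz'⟩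
  · rintro y ⟨hyδ, hy0, hy1⟩
    constructor
    · intro hy
      obtain ⟨j, hj⟩ := mem_iUnion.1 hy
      by_cases hji : j = i
      · subst hji
        rw [edgeSet_eq_segment] at hj
        exact orient_eq_zero_of_mem_segment hj
      · exact absurd (mem_iUnion.2 ⟨⟨j, hji⟩, hj⟩) (hδN hyδ)
    · intro hy
      refine edgeSet_subset_boundary P i ?_
      rw [edgeSet_eq_segment, segment_eq_image_lineMap]
      refine ⟨τ y / τ q, ⟨by positivity, (div_le_one hτq).2 hy1.le⟩, ?_⟩
      have e0 : τ q * (y 0 - p 0) = τ y * (q 0 - p 0) := by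
        simp only [τ, orient] at hy ⊢
        linear_combination (-(q 1 - p 1)) * hy
      have e1 : τ q * (y 1 - p 1) = τ y * (q 1 - p 1) := by
        simp only [τ, orient] at hy ⊢
        linear_combination (q 0 - p 0) * hy
      apply plane_ext
      · simp only [AffineMap.lineMap_apply_module', PiLp.add_apply, PiLp.smul_apply,
          PiLp.sub_apply, smul_eq_mul]
        change τ y / τ q * (q 0 - p 0) + p 0 = y 0
        rw [div_mul_eq_mul_div, ← e0, mul_div_cancel_left₀ _ hτq.ne']
        ring
      · simp only [AffineMap.lineMap_apply_module', PiLp.add_apply, PiLp.smul_apply,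
          PiLp.sub_apply, smul_eq_mul]
        change τ y / τ q * (q 1 - p 1) + p 1 = y 1
        rw [div_mul_eq_mul_div, ← e1, mul_div_cancel_left₀ _ hτq.ne']
        ring

/-- A point of a line lies in the closure of each open side of that line, also within an open
set. -/
theorem mem_closure_side {k : ℝ} (hk : k ≠ 0) {p q z : Plane} (hpq : p ≠ q) {W : Set Plane}
    (hW : IsOpen W) (hz : z ∈ W) (h0 : orient p q z = 0) :
    z ∈ closure (W ∩ {y | 0 < k * orient p q y}) := by
  obtain ⟨v, hv⟩ := exists_normal p q
  have hc : Continuous fun t : ℝ => z + (t * k) • v := by fun_prop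
  have ht : Tendsto (fun t : ℝ => z + (t * k) • v) (𝓝[>] 0) (𝓝 z) := by
    have := hc.tendsto 0
    simp only [zero_mul, zero_smul, add_zero] at this
    exact this.mono_left nhdsWithin_le_nhds
  refine mem_closure_of_tendsto ht ?_
  filter_upwards [ht.eventually_mem (hW.mem_nhds hz), self_mem_nhdsWithin] with t h1 h2
  refine ⟨h1, ?_⟩
  have hd : 0 < dist p q := dist_pos.2 hpq
  have h2 : 0 < t := h2
  have hk2 : 0 < k ^ 2 := by positivity
  have : 0 < t * (k ^ 2 * dist p q ^ 2) := by positivity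
  change 0 < k * orient p q (z + (t * k) • v)
  rw [hv, h0]
  nlinarith

theorem mem_openSegment_orient {p q x : Plane} (hx : x ∈ openSegment ℝ p q) : orient p q x = 0 :=
  orient_eq_zero_of_mem_segment (openSegment_subset_segment _ _ _ hx)

/-- A union of complementary components that approaches an inner point of an edge approaches the
whole edge: it contains a thin strip along one side of the edge. -/
theorem IsSimple.edgeSet_subset_closure {m : ℕ} {P : Polygon Plane m} (hP : IsSimple P)
    {U : Set Plane} (hU : IsComponentUnion (P.boundary ℝ) U) (i : Fin m) {x : Plane}
    (hx : x ∈ openSegment ℝ (P i) (P (finRotate m i))) (hxU : x ∈ closure U) :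
    P.edgeSet ℝ i ⊆ closure U := by
  have key : openSegment ℝ (P i) (P (finRotate m i)) ⊆ closure U := by
    intro z hz
    obtain ⟨W, hWo, hWc, hxW, hzW, hW⟩ := hP.exists_nhds_edge i hx hz
    obtain ⟨y, hyW, hyU⟩ := mem_closure_iff.1 hxU W hWo hxW
    set k := orient (P i) (P (finRotate m i)) y
    have hk : k ≠ 0 := fun h => hU.subset_compl hyU ((hW y hyW).2 h)
    have hS : W ∩ {y | 0 < k * orient (P i) (P (finRotate m i)) y} ⊆ U := by
      refine hU.of_inter _ (hWc.inter (convex_orient_pos k _ _)).isPreconnected ?_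
        ⟨y, ⟨hyW, mul_self_pos.2 hk⟩, hyU⟩
      rintro w ⟨hw, hw0⟩ hwB
      rw [mem_ofPred_eq] at hw0
      rw [(hW w hw).1 hwB, mul_zero] at hw0
      exact lt_irrefl _ hw0
    exact closure_mono hS (mem_closure_side hk (hP.ne i) hWo hzW (mem_openSegment_orient hz))
  rw [edgeSet_eq_segment, ← closure_openSegment]
  exact closure_minimal key isClosed_closure

/-- The point with polar coordinates `(r, θ)` around `v`. -/
noncomputable def polar (v : Plane) (r θ : ℝ) : Plane := v + r • !₂[Real.cos θ, Real.sin θ]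

theorem polar_zero (v : Plane) (r θ : ℝ) : polar v r θ 0 = v 0 + r * Real.cos θ := by
  simp [polar]

theorem polar_one (v : Plane) (r θ : ℝ) : polar v r θ 1 = v 1 + r * Real.sin θ := by
  simp [polar]

theorem continuous_polar (v : Plane) (r : ℝ) : Continuous (polar v r) := by
  unfold polar
  refine continuous_const.add (Continuous.const_smul ?_ r)
  refine (PiLp.continuous_toLp 2 _).comp ?_
  refine continuous_pi fun i => ?_
  fin_cases i
  · exact Real.continuous_cos
  · exact Real.continuous_sin

theorem dist_polar (v : Plane) {r : ℝ} (hr : 0 ≤ r) (θ : ℝ) : dist (polar v r θ) v = r := by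
  rw [EuclideanSpace.dist_eq]
  simp only [Fin.sum_univ_two, Real.dist_eq, sq_abs, polar_zero, polar_one]
  rw [show (v 0 + r * Real.cos θ - v 0) ^ 2 + (v 1 + r * Real.sin θ - v 1) ^ 2 = r ^ 2 by
    linear_combination r ^ 2 * Real.sin_sq_add_cos_sq θ]
  exact Real.sqrt_sq hr

/-- Polar coordinates around `v`, with the angle in a prescribed half-open interval. -/
theorem exists_polar (v y : Plane) (α : ℝ) :
    ∃ θ, α < θ ∧ θ ≤ α + 2 * Real.pi ∧ y = polar v (dist y v) θ := by
  set w : ℂ := ⟨y 0 - v 0, y 1 - v 1⟩ with hw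
  have hn : ‖w‖ = dist y v := by
    rw [EuclideanSpace.dist_eq, Complex.norm_def, Complex.normSq_apply]
    simp only [Fin.sum_univ_two, Real.dist_eq, sq_abs, hw]
    congr 1
    ring
  have h2 : 0 < 2 * Real.pi := Real.two_pi_pos
  have hc : Real.cos (toIocMod h2 α w.arg) = Real.cos w.arg := by
    rw [toIocMod, zsmul_eq_mul, Real.cos_sub_int_mul_two_pi]
  have hs : Real.sin (toIocMod h2 α w.arg) = Real.sin w.arg := by
    rw [toIocMod, zsmul_eq_mul, Real.sin_sub_int_mul_two_pi]
  refine ⟨toIocMod h2 α w.arg, (toIocMod_mem_Ioc h2 α _).1, (toIocMod_mem_Ioc h2 α _).2, ?_⟩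
  apply plane_ext
  · rw [polar_zero, hc, ← hn, Complex.norm_mul_cos_arg]
    simp [hw]
  · rw [polar_one, hs, ← hn, Complex.norm_mul_sin_arg]
    simp [hw]

theorem polar_add_two_pi (v : Plane) (r θ : ℝ) : polar v r (θ + 2 * Real.pi) = polar v r θ := by
  simp [polar]

theorem polar_mem_openSegment {v : Plane} {r R θ : ℝ} (h0 : 0 < r) (h1 : r < R) :
    polar v r θ ∈ openSegment ℝ v (polar v R θ) := by
  have hR : 0 < R := h0.trans h1
  refine ⟨1 - r / R, r / R, by rw [sub_pos, div_lt_one hR]; exact h1, by positivity, by ring, ?_⟩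
  apply plane_ext <;>
    · simp only [PiLp.add_apply, PiLp.smul_apply, smul_eq_mul, polar_zero, polar_one]
      field_simp
      ring

theorem eq_of_polar_mem_segment {v : Plane} {r R θ β : ℝ} (hr : 0 < r) (hR : 0 < R)
    (h : polar v r θ ∈ segment ℝ v (polar v R β)) : ∃ k : ℤ, θ - β = 2 * Real.pi * k := by
  obtain ⟨a, b, ha, hb, hab, e⟩ := h
  obtain rfl : a = 1 - b := by linarith
  have e0 := congrArg (fun z : Plane => z 0) e
  have e1 := congrArg (fun z : Plane => z 1) e
  simp only [PiLp.add_apply, PiLp.smul_apply, smul_eq_mul, polar_zero, polar_one] at e0 e1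
  have c0 : b * R * Real.cos β = r * Real.cos θ := by linear_combination e0
  have c1 : b * R * Real.sin β = r * Real.sin θ := by linear_combination e1
  have hsq : (b * R) ^ 2 = r ^ 2 := by
    have s1 := Real.sin_sq_add_cos_sq β
    have s2 := Real.sin_sq_add_cos_sq θ
    calc (b * R) ^ 2 = (b * R * Real.cos β) ^ 2 + (b * R * Real.sin β) ^ 2 := by
          linear_combination -(b * R) ^ 2 * s1
      _ = r ^ 2 := by rw [c0, c1]; linear_combination r ^ 2 * s2
  have hbr : b * R = r := by
    rcases sq_eq_sq_iff_eq_or_eq_neg.1 hsq with h | h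
    · exact h
    · nlinarith [mul_nonneg hb hR.le]
  rw [hbr] at c0 c1
  exact Real.Angle.angle_eq_iff_two_pi_dvd_sub.1 (Real.Angle.cos_sin_inj
    (mul_left_cancel₀ hr.ne' c0).symm (mul_left_cancel₀ hr.ne' c1).symm)

/-- If a circle around `v` contains a point of `U` and meets the boundary in two points only, then
both are limits of points of `U`: rotate the point of `U` in both directions. -/
theorem IsComponentUnion.polar_mem_closure {B U : Set Plane} (hU : IsComponentUnion B U)
    {v : Plane} {r α β γ : ℝ} (hα : polar v r α ∈ U) (hβ : α < β) (hβγ : β < γ)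
    (hγ : γ < α + 2 * Real.pi)
    (hB : ∀ θ, α ≤ θ → θ ≤ α + 2 * Real.pi → polar v r θ ∈ B → θ = β ∨ θ = γ) :
    polar v r β ∈ closure U ∧ polar v r γ ∈ closure U := by
  have hc := continuous_polar v r
  constructor
  · have hS : polar v r '' Ico α β ⊆ U := by
      refine hU.of_inter _ (isPreconnected_Ico.image _ hc.continuousOn) ?_
        ⟨_, ⟨α, ⟨le_rfl, hβ⟩, rfl⟩, hα⟩
      rintro _ ⟨θ, ⟨h1, h2⟩, rfl⟩ hθ
      rcases hB θ h1 (by linarith) hθ with h | h <;> linarith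
    refine closure_mono hS (image_closure_subset_closure_image hc ⟨β, ?_, rfl⟩)
    rw [closure_Ico hβ.ne]
    exact right_mem_Icc.2 hβ.le
  · have hS : polar v r '' Ioc γ (α + 2 * Real.pi) ⊆ U := by
      refine hU.of_inter _ (isPreconnected_Ioc.image _ hc.continuousOn) ?_
        ⟨_, ⟨α + 2 * Real.pi, ⟨hγ, le_rfl⟩, polar_add_two_pi v r α⟩, hα⟩
      rintro _ ⟨θ, ⟨h1, h2⟩, rfl⟩ hθ
      rcases hB θ (by linarith) h2 hθ with h | h <;> linarith
    refine closure_mono hS (image_closure_subset_closure_image hc ⟨γ, ?_, rfl⟩)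
    rw [closure_Ioc hγ.ne]
    exact left_mem_Icc.2 hγ.le

/-- A union of complementary components that approaches a vertex approaches the edges there: on a
small circle around the vertex, one can move from any point off the boundary to either edge. -/
theorem IsSimple.edgeSet_subset_closure_of_vertex {m : ℕ} {P : Polygon Plane m} (hP : IsSimple P)
    {U : Set Plane} (hU : IsComponentUnion (P.boundary ℝ) U) (i' : Fin m)
    (hv : P (finRotate m i') ∈ closure U) :
    P.edgeSet ℝ (finRotate m i') ⊆ closure U := by
  set i := finRotate m i' with hi
  set v := P i with hvdef
  have hm := hP.three_le
  have hav : P (finRotate m i) ≠ v := (hP.ne i).symm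
  have hbv : P i' ≠ v := hP.ne i'
  have hne : i ≠ i' := finRotate_ne_self (by omega) i'
  -- a disc around `v` that misses all the other edges
  have hN : IsClosed (⋃ j : {j : Fin m // j ≠ i ∧ j ≠ i'}, P.edgeSet ℝ j) :=
    isClosed_iUnion_of_finite fun j => (isCompact_edgeSet P j).isClosed
  have hvN : v ∉ ⋃ j : {j : Fin m // j ≠ i ∧ j ≠ i'}, P.edgeSet ℝ j := by
    intro h
    obtain ⟨⟨j, hji, hji'⟩, hj⟩ := mem_iUnion.1 h
    have := (hP.edge_inter i j hji.symm).subset ⟨vertex_mem_edgeSet P i, hj⟩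
    rcases this.2 with h | h
    · exact hji (hP.injective h).symm
    · exact hji' ((finRotate m).injective (hP.injective h)).symm
  obtain ⟨ρ, hρ, hρN⟩ := Metric.isOpen_iff.1 hN.isOpen_compl v hvN
  set ra := dist (P (finRotate m i)) v
  set rb := dist (P i') v
  have hra : 0 < ra := dist_pos.2 hav
  have hrb : 0 < rb := dist_pos.2 hbv
  obtain ⟨y, hyball, hyU⟩ := mem_closure_iff.1 hv (Metric.ball v (min ρ (min ra rb)))
    Metric.isOpen_ball (Metric.mem_ball_self (by positivity))
  have hyB : y ∉ P.boundary ℝ := hU.subset_compl hyU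
  have hyv : y ≠ v := by
    rintro rfl
    exact hyB (edgeSet_subset_boundary P i (vertex_mem_edgeSet P i))
  obtain ⟨α, -, -, hα⟩ := exists_polar v y 0
  set r := dist y v with hr
  have hr0 : 0 < r := dist_pos.2 hyv
  obtain ⟨hrρ, hrab⟩ := lt_min_iff.1 (Metric.mem_ball.1 hyball)
  obtain ⟨hrra, hrrb⟩ := lt_min_iff.1 hrab
  obtain ⟨β, hβ0, hβ1, hβ⟩ := exists_polar v (P (finRotate m i)) α
  obtain ⟨γ, hγ0, hγ1, hγ⟩ := exists_polar v (P i') α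
  have hoa : polar v r β ∈ openSegment ℝ (P i) (P (finRotate m i)) := by
    rw [hβ]; exact polar_mem_openSegment hr0 hrra
  have hob : polar v r γ ∈ openSegment ℝ (P i') (P (finRotate m i')) := by
    rw [openSegment_symm, hγ]; exact polar_mem_openSegment hr0 hrrb
  have hBa : polar v r β ∈ P.boundary ℝ := by
    refine edgeSet_subset_boundary P i ?_
    rw [edgeSet_eq_segment]; exact openSegment_subset_segment _ _ _ hoa
  have hBb : polar v r γ ∈ P.boundary ℝ := by
    refine edgeSet_subset_boundary P i' ?_
    rw [edgeSet_eq_segment]; exact openSegment_subset_segment _ _ _ hob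
  have hβ2 : β < α + 2 * Real.pi := by
    refine lt_of_le_of_ne hβ1 fun h => hyB ?_
    rw [h, polar_add_two_pi, ← hα] at hBa
    exact hBa
  have hγ2 : γ < α + 2 * Real.pi := by
    refine lt_of_le_of_ne hγ1 fun h => hyB ?_
    rw [h, polar_add_two_pi, ← hα] at hBb
    exact hBb
  have hβγ : β ≠ γ := by
    rintro rfl
    refine hP.openSegment_disjoint hne hoa ?_
    rw [edgeSet_eq_segment]
    exact openSegment_subset_segment _ _ _ hob
  -- angles in the range that agree modulo `2 * π` are equal
  have hmod : ∀ θ δ : ℝ, α ≤ θ → θ ≤ α + 2 * Real.pi → α < δ → δ < α + 2 * Real.pi →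
      (∃ k : ℤ, θ - δ = 2 * Real.pi * k) → θ = δ := by
    rintro θ δ h1 h2 h3 h4 ⟨k, hk⟩
    have hpi := Real.two_pi_pos
    have k1 : (k : ℝ) < 1 := by
      by_contra! h
      nlinarith
    have k2 : (-1 : ℝ) < k := by
      by_contra! h
      nlinarith
    have k0 : k = 0 := by
      have : k < 1 := by exact_mod_cast k1
      have : -1 < k := by exact_mod_cast k2
      omega
    rw [k0] at hk
    simp at hk
    linarith
  have hB : ∀ θ, α ≤ θ → θ ≤ α + 2 * Real.pi → polar v r θ ∈ P.boundary ℝ → θ = β ∨ θ = γ := by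
    intro θ h1 h2 hθ
    obtain ⟨j, hj⟩ := mem_iUnion.1 hθ
    by_cases hji : j = i
    · left
      subst hji
      rw [edgeSet_eq_segment, hβ] at hj
      exact hmod _ _ h1 h2 hβ0 hβ2 (eq_of_polar_mem_segment hr0 hra hj)
    by_cases hji' : j = i'
    · right
      subst hji'
      rw [edgeSet_eq_segment, segment_symm, hγ] at hj
      exact hmod _ _ h1 h2 hγ0 hγ2 (eq_of_polar_mem_segment hr0 hrb hj)
    · refine absurd (mem_iUnion.2 ⟨⟨j, hji, hji'⟩, hj⟩) (hρN ?_)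
      rw [Metric.mem_ball, dist_polar v hr0.le]
      exact hrρ
  rw [hα] at hyU
  refine hP.edgeSet_subset_closure hU i hoa ?_
  rcases hβγ.lt_or_gt with h | h
  · exact (hU.polar_mem_closure hyU hβ0 h hγ2 hB).1
  · exact (hU.polar_mem_closure hyU hγ0 h hβ2 fun θ h1 h2 h3 => (hB θ h1 h2 h3).symm).2

theorem forall_of_finRotate {m : ℕ} {Q : Fin m → Prop} (h : ∀ i, Q i → Q (finRotate m i))
    {i : Fin m} (hi : Q i) (j : Fin m) : Q j := by
  obtain ⟨k, rfl⟩ : ∃ k, m = k + 1 := ⟨m - 1, by have := i.pos; omega⟩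
  have key : ∀ t : ℕ, Q (i + Fin.ofNat (k + 1) t) := by
    intro t
    induction t with
    | zero => simpa using hi
    | succ t ih =>
      have := h _ ih
      rw [finRotate_apply, add_assoc] at this
      convert this using 2
      ext
      simp [Fin.val_add]
  have := key (j - i).val
  simpa using this

/-- The part of the Jordan curve theorem that is needed: every component of the complement of a
simple polygon approaches every boundary point. -/
theorem IsSimple.boundary_subset_closure {m : ℕ} {P : Polygon Plane m} (hP : IsSimple P)
    {U : Set Plane} (hU : IsComponentUnion (P.boundary ℝ) U) (hne : U.Nonempty) :
    P.boundary ℝ ⊆ closure U := by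
  have hBc := (isCompact_boundary P).isClosed
  have hnhd : ∀ x ∉ P.boundary ℝ, ∃ ε > 0, Metric.ball x ε ⊆ (P.boundary ℝ)ᶜ := fun x hx =>
    Metric.isOpen_iff.1 hBc.isOpen_compl x hx
  have hUo : IsOpen U := by
    rw [Metric.isOpen_iff]
    intro x hx
    obtain ⟨ε, hε, h⟩ := hnhd x (hU.subset_compl hx)
    exact ⟨ε, hε, hU.of_inter _ (convex_ball x ε).isPreconnected h
      ⟨x, Metric.mem_ball_self hε, hx⟩⟩
  obtain ⟨x, hxU, hxB⟩ : ∃ x ∈ closure U, x ∈ P.boundary ℝ := by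
    by_contra! h
    have hUc : IsClosed U := by
      refine closure_subset_iff_isClosed.1 fun x hx => ?_
      obtain ⟨ε, hε, hb⟩ := hnhd x (h x hx)
      obtain ⟨y, hy⟩ := mem_closure_iff.1 hx _ Metric.isOpen_ball (Metric.mem_ball_self hε)
      exact hU.of_inter _ (convex_ball x ε).isPreconnected hb ⟨y, hy⟩ (Metric.mem_ball_self hε)
    have huniv := (IsClopen.eq_univ ⟨hUc, hUo⟩ hne)
    have h3 := hP.three_le
    exact hU.subset_compl (huniv ▸ mem_univ (P ⟨0, by omega⟩))
      (edgeSet_subset_boundary P _ (vertex_mem_edgeSet P _))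
  -- some vertex is a limit point of `U`
  obtain ⟨i, hi⟩ : ∃ i, P (finRotate m i) ∈ closure U := by
    obtain ⟨i, hi⟩ := mem_iUnion.1 hxB
    rw [edgeSet_eq_segment, ← insert_endpoints_openSegment] at hi
    rcases hi with rfl | rfl | hi
    · exact ⟨(finRotate m).symm i, by rwa [Equiv.apply_symm_apply]⟩
    · exact ⟨i, hxU⟩
    · exact ⟨i, hP.edgeSet_subset_closure hU i hi hxU (vertex_mem_edgeSet' P i)⟩
  have hall := forall_of_finRotate (Q := fun i => P (finRotate m i) ∈ closure U)
    (fun i hi => hP.edgeSet_subset_closure_of_vertex hU i hi (vertex_mem_edgeSet' P _)) hi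
  refine iUnion_subset fun j => ?_
  have := hP.edgeSet_subset_closure_of_vertex hU _ (hall ((finRotate m).symm j))
  rwa [Equiv.apply_symm_apply] at this

theorem isComponentUnion_compl_region {m : ℕ} (P : Polygon Plane m) :
    IsComponentUnion (P.boundary ℝ) (region P)ᶜ := by
  refine ⟨fun x hx hB => hx (Or.inl hB), ?_⟩
  rintro S hS hSB ⟨y, hyS, hyU⟩ z hz hzR
  rcases hzR with h | ⟨h, hb⟩
  · exact hSB hz h
  · refine hyU (Or.inr ⟨hSB hyS, ?_⟩)
    rwa [connectedComponentIn_eq (hS.subset_connectedComponentIn hz hSB hyS)] at hb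

theorem isComponentUnion_connectedComponentIn {B : Set Plane} {x : Plane} :
    IsComponentUnion B (connectedComponentIn Bᶜ x) := by
  refine ⟨connectedComponentIn_subset _ _, ?_⟩
  rintro S hS hSB ⟨y, hyS, hyC⟩
  rw [connectedComponentIn_eq hyC]
  exact hS.subset_connectedComponentIn hyS hSB

theorem compl_region_nonempty {m : ℕ} (P : Polygon Plane m) : (region P)ᶜ.Nonempty := by
  obtain ⟨R, hR⟩ := (isCompact_boundary P).isBounded.subset_closedBall 0
  -- the ray `{c • e | 1 ≤ c}` misses the boundary
  set e : Plane := EuclideanSpace.single 0 (|R| + 1) with he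
  have hen : ‖e‖ = |R| + 1 := by
    rw [he, PiLp.norm_single, Real.norm_of_nonneg (by positivity)]
  have hray : (fun c : ℝ => c • e) '' Ici 1 ⊆ (P.boundary ℝ)ᶜ := by
    rintro _ ⟨c, hc, rfl⟩ hB
    have := hR hB
    rw [mem_closedBall_zero_iff, norm_smul, hen] at this
    have hc : (1 : ℝ) ≤ c := hc
    rw [Real.norm_of_nonneg (by linarith)] at this
    nlinarith [le_abs_self R, abs_nonneg R]
  have hmem : e ∈ (fun c : ℝ => c • e) '' Ici 1 := ⟨1, by simp, one_smul _ _⟩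
  refine ⟨e, fun h => ?_⟩
  rcases h with h | ⟨h, hb⟩
  · exact hray hmem h
  · have hpre : IsPreconnected ((fun c : ℝ => c • e) '' Ici 1) :=
      isPreconnected_Ici.image _ (by fun_prop)
    obtain ⟨C, hC⟩ := (hb.subset (hpre.subset_connectedComponentIn hmem hray)).subset_closedBall 0
    have := hC ⟨|C| + 1, by simp, rfl⟩
    rw [mem_closedBall_zero_iff, norm_smul, hen, Real.norm_of_nonneg (by positivity)] at this
    nlinarith [le_abs_self C, abs_nonneg C, abs_nonneg R]

/-- Every boundary point is a limit of outer points. -/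
theorem IsSimple.boundary_subset_closure_compl_region {m : ℕ} {P : Polygon Plane m}
    (hP : IsSimple P) : P.boundary ℝ ⊆ closure (region P)ᶜ :=
  hP.boundary_subset_closure (isComponentUnion_compl_region P) (compl_region_nonempty P)

/-- A closed bounded set with boundary points of the polygon only on its frontier is the region of
the polygon if it fills one side of some edge locally. -/
theorem IsSimple.region_eq {m : ℕ} {P : Polygon Plane m} (hP : IsSimple P) {F : Set Plane}
    (hc : IsClosed F) (hb : Bornology.IsBounded F) (hBF : P.boundary ℝ ⊆ F)
    (ho : IsOpen (F \ P.boundary ℝ)) {i : Fin m} {z : Plane}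
    (hz : z ∈ openSegment ℝ (P i) (P (finRotate m i))) {k : ℝ} (hk : k ≠ 0)
    (hside : ∀ᶠ y in 𝓝 z, 0 ≤ k * orient (P i) (P (finRotate m i)) y → y ∈ F) :
    region P = F := by
  have hFU : IsComponentUnion (P.boundary ℝ) (F \ P.boundary ℝ) := by
    refine ⟨fun x hx => hx.2, ?_⟩
    intro S hS hSB hne
    refine hS.subset_left_of_subset_union ho hc.isOpen_compl ?_ ?_ hne
    · exact disjoint_left.2 fun x hx hx' => hx' hx.1
    · intro x hx
      by_cases hxF : x ∈ F
      · exact Or.inl ⟨hxF, hSB hx⟩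
      · exact Or.inr hxF
  have hFR : F ⊆ region P := by
    intro x hx
    by_cases hxB : x ∈ P.boundary ℝ
    · exact Or.inl hxB
    · refine Or.inr ⟨hxB, hb.subset ?_⟩
      exact (hFU.of_inter _ isPreconnected_connectedComponentIn
        (connectedComponentIn_subset _ _) ⟨x, mem_connectedComponentIn hxB, hx, hxB⟩).trans
          sdiff_subset
  refine Subset.antisymm (fun x hx => ?_) hFR
  by_contra hxF
  rcases hx with hxB | ⟨hxB, hxb⟩
  · exact hxF (hBF hxB)
  -- the component `C` of `x` is bounded and misses `F`
  set C := connectedComponentIn (P.boundary ℝ)ᶜ x with hC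
  have hCU : IsComponentUnion (P.boundary ℝ) C := isComponentUnion_connectedComponentIn
  have hxC : x ∈ C := mem_connectedComponentIn hxB
  have hCF : ∀ y ∈ C, y ∉ F := fun y hy hyF =>
    hxF (hFU.of_inter C isPreconnected_connectedComponentIn (connectedComponentIn_subset _ _)
      ⟨y, hy, hyF, connectedComponentIn_subset _ _ hy⟩ hxC).1
  have hCR : C ⊆ region P := by
    intro y hy
    refine Or.inr ⟨connectedComponentIn_subset _ _ hy, ?_⟩
    rwa [← connectedComponentIn_eq hy]
  -- both `C` and the outside reach `z`, necessarily on the side that `F` does not fill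
  obtain ⟨W, hWo, hWc, hzW, -, hW⟩ := hP.exists_nhds_edge i hz hz
  obtain ⟨ε, hε, hball⟩ := Metric.mem_nhds_iff.1
    (inter_mem (hWo.mem_nhds hzW) hside)
  have hzB : z ∈ P.boundary ℝ := (hW z hzW).2 (mem_openSegment_orient hz)
  have hS : ∀ U, IsComponentUnion (P.boundary ℝ) U → U.Nonempty → (∀ y ∈ U, y ∉ F) →
      Metric.ball z ε ∩ {y | 0 < (-k) * orient (P i) (P (finRotate m i)) y} ⊆ U := by
    intro U hU hUn hUF
    obtain ⟨y, hy, hyU⟩ := mem_closure_iff.1 (hP.boundary_subset_closure hU hUn hzB) _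
      Metric.isOpen_ball (Metric.mem_ball_self hε)
    refine hU.of_inter _ ((convex_ball z ε).inter (convex_orient_pos _ _ _)).isPreconnected ?_
      ⟨y, ⟨hy, ?_⟩, hyU⟩
    · rintro w ⟨hw, hw0⟩ hwB
      rw [mem_ofPred_eq] at hw0
      rw [(hW w (hball hw).1).1 hwB, mul_zero] at hw0
      exact lt_irrefl _ hw0
    · rw [mem_ofPred_eq]
      by_contra! h
      exact hUF y hyU ((hball hy).2 (by linarith))
  have h1 := hS C hCU ⟨x, hxC⟩ hCF
  have h2 := hS _ (isComponentUnion_compl_region P) (compl_region_nonempty P)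
    fun y hy hyF => hy (hFR hyF)
  obtain ⟨y, hy⟩ := closure_nonempty_iff.1 ⟨z, mem_closure_side (neg_ne_zero.2 hk) (hP.ne i)
    Metric.isOpen_ball (Metric.mem_ball_self hε) (mem_openSegment_orient hz)⟩
  exact h2 hy (hCR (h1 hy))

/-! ### Affine independence, separation of simplices, and triangles of a complex -/

theorem affineIndependent_of_orient {p q r : Plane} (h : orient p q r ≠ 0) :
    AffineIndependent ℝ ![p, q, r] := by
  rw [affineIndependent_iff_of_fintype]
  intro w hw hs
  rw [Finset.univ.weightedVSub_eq_linear_combination hw] at hs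
  simp only [Fin.sum_univ_three, Matrix.cons_val_zero, Matrix.cons_val_one, Matrix.cons_val] at hw hs
  have e0 := congrArg (fun z : Plane => z 0) hs
  have e1 := congrArg (fun z : Plane => z 1) hs
  simp only [PiLp.add_apply, PiLp.smul_apply, smul_eq_mul, PiLp.zero_apply] at e0 e1
  have hw0 : w 0 = -(w 1 + w 2) := by linarith
  rw [hw0] at e0 e1
  have h1 : w 1 = 0 := by
    refine (mul_eq_zero.1 (?_ : w 1 * orient p q r = 0)).resolve_right h
    simp only [orient]
    linear_combination (r 1 - p 1) * e0 - (r 0 - p 0) * e1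
  have h2 : w 2 = 0 := by
    refine (mul_eq_zero.1 (?_ : w 2 * orient p q r = 0)).resolve_right h
    simp only [orient]
    linear_combination (q 0 - p 0) * e1 - (q 1 - p 1) * e0
  intro i
  fin_cases i
  · simp [hw0, h1, h2]
  · exact h1
  · exact h2

theorem affineIndependent_subset_triangle {p q r : Plane} (h : orient p q r ≠ 0)
    {s : Finset Plane} (hs : (s : Set Plane) ⊆ {p, q, r}) :
    AffineIndependent ℝ ((↑) : s → Plane) := by
  have h1 := (affineIndependent_of_orient h).range
  refine AffineIndependent.mono h1 (hs.trans ?_)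
  rintro x (rfl | rfl | rfl)
  · exact ⟨0, rfl⟩
  · exact ⟨1, rfl⟩
  · exact ⟨2, rfl⟩

theorem affineIndependent_subset_pair {p q : Plane} (h : p ≠ q)
    {s : Finset Plane} (hs : (s : Set Plane) ⊆ {p, q}) :
    AffineIndependent ℝ ((↑) : s → Plane) := by
  have h1 := (affineIndependent_of_ne ℝ h).range
  refine AffineIndependent.mono h1 (hs.trans ?_)
  rintro x (rfl | rfl)
  · exact ⟨0, rfl⟩
  · exact ⟨1, rfl⟩

theorem orient_ne_zero_of_affineIndependent {p q r : Plane}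
    (h : AffineIndependent ℝ ![p, q, r]) : orient p q r ≠ 0 := by
  intro h0
  have hpq : p ≠ q := fun e => by
    have := h.injective (a₁ := 0) (a₂ := 1) (by simpa using e)
    simp at this
  obtain ⟨v, hv⟩ := exists_normal p q
  set x := p + (1 : ℝ) • v
  have hx : orient p q x = dist p q ^ 2 := by rw [hv]; simp
  rw [affineIndependent_iff_of_fintype] at h
  have hsum : ∑ i, ![orient q r x, orient r p x, orient p q x] i = 0 := by
    simp only [Fin.sum_univ_three, Matrix.cons_val_zero, Matrix.cons_val_one, Matrix.cons_val]
    rw [← h0]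
    simp only [orient]; ring
  have := h ![orient q r x, orient r p x, orient p q x] hsum (by
    rw [Finset.univ.weightedVSub_eq_linear_combination hsum]
    simp only [Fin.sum_univ_three, Matrix.cons_val_zero, Matrix.cons_val_one, Matrix.cons_val]
    rw [← orient_smul_eq, h0, zero_smul]) 2
  simp only [Matrix.cons_val] at this
  have hd : 0 < dist p q := dist_pos.2 hpq
  rw [hx] at this
  exact absurd this (by positivity)

/-- Two simplices on different sides of the line `p q` with no corners on this line except for `p`
and `q` meet in a common face. -/
theorem convexHull_inter_subset_of_separated {k : ℝ} {p q : Plane} (hpq : p ≠ q)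
    {s t : Finset Plane} (hs : ∀ y ∈ s, 0 ≤ k * orient p q y)
    (ht : ∀ y ∈ t, k * orient p q y ≤ 0)
    (hs0 : ∀ y ∈ s, k * orient p q y = 0 → y = p ∨ y = q)
    (ht0 : ∀ y ∈ t, k * orient p q y = 0 → y = p ∨ y = q) :
    convexHull ℝ (s : Set Plane) ∩ convexHull ℝ (t : Set Plane) ⊆
      convexHull ℝ ((s : Set Plane) ∩ t) := by
  classical
  rintro x ⟨hxs, hxt⟩
  have ht' : ∀ y ∈ t, 0 ≤ (-k) * orient p q y := fun y hy => by linarith [ht y hy]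
  have h1 : 0 ≤ k * orient p q x := orient_nonneg_of_mem_convexHull hs hxs
  have h2 : 0 ≤ (-k) * orient p q x := orient_nonneg_of_mem_convexHull ht' hxt
  have h3 := mem_convexHull_of_orient_eq_zero hs hxs (by linarith)
  have h4 := mem_convexHull_of_orient_eq_zero ht' hxt (by linarith)
  have e1 : {y | y ∈ s ∧ k * orient p q y = 0} =
      ((s.filter fun y => k * orient p q y = 0 : Finset Plane) : Set Plane) := by
    ext y; simp
  have e2 : {y | y ∈ t ∧ (-k) * orient p q y = 0} =
      ((t.filter fun y => k * orient p q y = 0 : Finset Plane) : Set Plane) := by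
    ext y; simp
  rw [e1] at h3
  rw [e2] at h4
  have hind := affineIndependent_subset_pair hpq (s := {p, q}) (by simp)
  have := (hind.convexHull_inter (t₁ := s.filter fun y => k * orient p q y = 0)
    (t₂ := t.filter fun y => k * orient p q y = 0) ?_ ?_).symm.subset ⟨h3, h4⟩
  · refine convexHull_mono ?_ this
    rintro y ⟨hy1, hy2⟩
    exact ⟨(Finset.mem_filter.1 hy1).1, (Finset.mem_filter.1 hy2).1⟩
  · intro y hy
    obtain ⟨hy1, hy2⟩ := Finset.mem_filter.1 hy
    simpa using hs0 y hy1 hy2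
  · intro y hy
    obtain ⟨hy1, hy2⟩ := Finset.mem_filter.1 hy
    simpa using ht0 y hy1 hy2

open scoped Classical in
theorem orient_ne_zero_of_mem_faces {K : SimplicialComplex ℝ Plane} {a b c : Plane}
    (h : {a, b, c} ∈ K.faces) (hab : a ≠ b) (hac : a ≠ c) (hbc : b ≠ c) : orient a b c ≠ 0 := by
  apply orient_ne_zero_of_affineIndependent
  let f : Fin 3 ↪ ({a, b, c} : Finset Plane) :=
    ⟨![⟨a, by simp⟩, ⟨b, by simp⟩, ⟨c, by simp⟩], by
      intro i j hij
      fin_cases i <;> fin_cases j <;> simp_all⟩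
  have e : ![a, b, c] = fun i => ((f i : ({a, b, c} : Finset Plane)) : Plane) := by
    funext i
    fin_cases i <;> rfl
  rw [e]
  exact (K.indep h).comp_embedding f

open scoped Classical in
/-- An edge of a complex has at most one triangle on each side. -/
theorem apex_unique {K : SimplicialComplex ℝ Plane} {p q w w' : Plane} {k : ℝ}
    (h : {p, q, w} ∈ K.faces) (h' : {p, q, w'} ∈ K.faces)
    (hw : 0 < k * orient p q w) (hw' : 0 < k * orient p q w') : w = w' := by
  by_contra hne
  have hpq : p ≠ q := by rintro rfl; simp at hw
  have hk : k ≠ 0 := by rintro rfl; simp at hw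
  -- the two triangles overlap near the midpoint of `p q`
  have hz := midpoint_mem_openSegment p q
  have hev := (eventually_mem_triangle hw hz).and (eventually_mem_triangle hw' hz)
  have hcl := mem_closure_side hk hpq (isOpen_univ) (mem_univ _) (mem_openSegment_orient hz)
  obtain ⟨y, ⟨-, hy⟩, hy1, hy2⟩ := ((mem_closure_iff_frequently.1 hcl).and_eventually hev).exists
  rw [mem_ofPred_eq] at hy
  have := K.inter_subset_convexHull h h' ⟨by simpa using hy1 hy.le, by simpa using hy2 hy.le⟩
  have h0 : y ∈ convexHull ℝ {p, q} := by
    refine convexHull_mono ?_ this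
    rintro z ⟨hz1, hz2⟩
    simp only [Finset.coe_insert, Finset.coe_singleton, mem_insert_iff, mem_singleton_iff] at hz1 hz2 ⊢
    rcases hz1 with h | h | h
    · exact Or.inl h
    · exact Or.inr h
    · rcases hz2 with h2 | h2 | h2
      · exact Or.inl h2
      · exact Or.inr h2
      · exact absurd (h.symm.trans h2) hne
  rw [convexHull_pair] at h0
  rw [orient_eq_zero_of_mem_segment h0, mul_zero] at hy
  exact lt_irrefl _ hy

/-! ### The order type of a double chain -/

/-- The order type of a double chain: the orientations of all triples of chain points, up to a
global sign given by `σ`. Of the sequences `u` and `l` only the first `n` points count. -/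
structure ChainPair (n : ℕ) (σ : ℝ) (u l : ℕ → Plane) : Prop where
  two_le : 2 ≤ n
  uul : ∀ a b k, a < b → b < n → k < n → 0 < σ * orient (u a) (u b) (l k)
  llu : ∀ a b k, a < b → b < n → k < n → σ * orient (l a) (l b) (u k) < 0
  uuu : ∀ a b c, a < b → b < c → c < n → σ * orient (u a) (u b) (u c) < 0
  lll : ∀ a b c, a < b → b < c → c < n → 0 < σ * orient (l a) (l b) (l c)

namespace ChainPair

variable {n : ℕ} {σ : ℝ} {u l : ℕ → Plane}

protected theorem symm (H : ChainPair n σ u l) : ChainPair n (-σ) l u where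
  two_le := H.two_le
  uul a b k h1 h2 h3 := by linarith [H.llu a b k h1 h2 h3]
  llu a b k h1 h2 h3 := by linarith [H.uul a b k h1 h2 h3]
  uuu a b k h1 h2 h3 := by linarith [H.lll a b k h1 h2 h3]
  lll a b k h1 h2 h3 := by linarith [H.uuu a b k h1 h2 h3]

theorem sign_ne_zero (H : ChainPair n σ u l) : σ ≠ 0 := by
  rintro rfl
  have := H.two_le
  simpa using H.uul 0 1 0 (by omega) (by omega) (by omega)

/-- From a line `u i, l j`, all later points lie on one side. -/
theorem diag_u_lt (H : ChainPair n σ u l) {i j k : ℕ} (hik : i < k) (hk : k < n) (hj : j < n) :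
    σ * orient (u i) (l j) (u k) < 0 := by
  have := H.uul i k j hik hk hj
  rw [orient_swap_right]; linarith

theorem diag_u_gt (H : ChainPair n σ u l) {i j k : ℕ} (hik : k < i) (hi : i < n) (hj : j < n) :
    0 < σ * orient (u i) (l j) (u k) := by
  have := H.uul k i j hik hi hj
  rwa [← orient_rotate] at this

theorem diag_l_lt (H : ChainPair n σ u l) {i j k : ℕ} (hjk : j < k) (hk : k < n) (hi : i < n) :
    σ * orient (u i) (l j) (l k) < 0 := by
  have := H.llu j k i hjk hk hi
  rwa [orient_rotate] at this

theorem diag_l_gt (H : ChainPair n σ u l) {i j k : ℕ} (hjk : k < j) (hj : j < n) (hi : i < n) :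
    0 < σ * orient (u i) (l j) (l k) := by
  have := H.llu k j i hjk hj hi
  rw [orient_rotate] at this
  rw [orient_swap_right]; linarith

theorem u_ne_l (H : ChainPair n σ u l) {i j : ℕ} (hi : i < n) (hj : j < n) : u i ≠ l j := by
  intro h
  have h2 := H.two_le
  rcases Nat.eq_zero_or_pos i with rfl | h0
  · have := H.diag_u_lt (i := 0) (j := j) (k := 1) (by omega) (by omega) hj
    rw [h] at this; simp at this
  · have := H.diag_u_gt h0 hi hj
    rw [h] at this; simp at this

theorem u_injective (H : ChainPair n σ u l) {i j : ℕ} (hi : i < n) (hj : j < n)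
    (h : u i = u j) : i = j := by
  have h2 := H.two_le
  rcases lt_trichotomy i j with h1 | h1 | h1
  · have := H.uul i j 0 h1 hj (by omega)
    rw [h] at this; simp at this
  · exact h1
  · have := H.uul j i 0 h1 hi (by omega)
    rw [h] at this; simp at this

/-- All other chain points are strictly beyond the line through a chain edge. -/
theorem edge_u (H : ChainPair n σ u l) {i k : ℕ} (hi : i + 1 < n) (hk : k < n) (h1 : k ≠ i)
    (h2 : k ≠ i + 1) : σ * orient (u i) (u (i + 1)) (u k) < 0 := by
  rcases lt_or_ge k i with h | h
  · have := H.uuu k i (i + 1) h (by omega) hi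
    rwa [← orient_rotate] at this
  · exact H.uuu i (i + 1) k (by omega) (by omega) hk

theorem edge_u_nonpos (H : ChainPair n σ u l) {i k : ℕ} (hi : i + 1 < n) (hk : k < n) :
    σ * orient (u i) (u (i + 1)) (u k) ≤ 0 := by
  by_cases h1 : k = i
  · simp [h1]
  by_cases h2 : k = i + 1
  · simp [h2]
  exact (H.edge_u hi hk h1 h2).le

end ChainPair

/-- Orientations within one chain and one point of the other chain, from the position of the reflex
corners. -/
theorem exists_sign_of_reflex {n : ℕ} (hn : 3 ≤ n) {u l : ℕ → Plane}
    (h : ∀ a b c k, a < b → b < c → c < n → k < n →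
      u b ∈ interior (convexHull ℝ {u a, u c, l k})) :
    ∃ T : ℝ, (∀ a b k, a < b → b < n → k < n → 0 < T * orient (u a) (u b) (l k)) ∧
      ∀ a b c, a < b → b < c → c < n → T * orient (u a) (u b) (u c) < 0 := by
  have key : ∀ a b c k, a < b → b < c → c < n → k < n →
      0 < orient (u a) (u c) (l k) * orient (u a) (u b) (l k) ∧
      0 < orient (u a) (u c) (l k) * orient (u b) (u c) (l k) ∧
      orient (u a) (u c) (l k) * orient (u a) (u b) (u c) < 0 := by
    intro a b c k hab hbc hc hk
    obtain ⟨h1, h2, h3⟩ := orient_of_mem_interior_triangle (h a b c k hab hbc hc hk)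
    rw [orient_swap_right (u a) (u b) (u c)] at h1
    rw [← orient_rotate (u c) (l k) (u b), ← orient_rotate (l k) (u b) (u c)] at h2
    rw [← orient_rotate (l k) (u a) (u b)] at h3
    exact ⟨h3, h2, by linarith⟩
  -- a product rule for signs
  have sgn : ∀ x y z : ℝ, 0 < x * y → 0 < x * z → 0 < y * z := by
    intro x y z hxy hxz
    rcases pos_and_pos_or_neg_and_neg_of_mul_pos hxy with ⟨hx, hy⟩ | ⟨hx, hy⟩
    · exact mul_pos hy ((mul_pos_iff_of_pos_left hx).1 hxz)
    · exact mul_pos_of_neg_of_neg hy (neg_of_mul_pos_right hxz hx.le)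
  have sgn' : ∀ x y z : ℝ, 0 < x * y → x * z < 0 → y * z < 0 := by
    intro x y z hxy hxz
    have := sgn x y (-z) hxy (by linarith)
    linarith
  have full : ∀ a b k, a < b → b < n → k < n →
      0 < orient (u 0) (u (n - 1)) (l k) * orient (u a) (u b) (l k) := by
    intro a b k hab hb hk
    by_cases ha : a = 0
    · subst ha
      by_cases hb' : b = n - 1
      · subst hb'
        have := (key 0 1 (n - 1) k (by omega) (by omega) (by omega) hk).1
        exact mul_self_pos.2 fun h0 => by rw [h0] at this; simp at this
      · exact (key 0 b (n - 1) k hab (by omega) (by omega) hk).1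
    · have h1 := (key 0 a (n - 1) k (by omega) (by omega) (by omega) hk).2.1
      by_cases hb' : b = n - 1
      · subst hb'; exact h1
      · have h2 := (key a b (n - 1) k hab (by omega) (by omega) hk).1
        exact sgn _ _ _ (by rw [mul_comm]; exact h1) h2
  have hT : ∀ k < n, 0 < orient (u 0) (u (n - 1)) (l k) * -orient (u 0) (u 1) (u (n - 1)) := by
    intro k hk
    linarith [(key 0 1 (n - 1) k (by omega) (by omega) (by omega) hk).2.2]
  have hT2 : ∀ a b k, a < b → b < n → k < n →
      0 < -orient (u 0) (u 1) (u (n - 1)) * orient (u a) (u b) (l k) :=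
    fun a b k hab hb hk => sgn _ _ _ (hT k hk) (full a b k hab hb hk)
  refine ⟨_, hT2, fun a b c hab hbc hc => ?_⟩
  exact sgn' _ _ _ (by rw [mul_comm]; exact hT2 a c 0 (by omega) hc (by omega))
    (key a b c 0 hab hbc hc (by omega)).2.2

/-- The union of the two chains and the two segments that join their end points. -/
def chainBoundary (n : ℕ) (u l : ℕ → Plane) : Set Plane :=
  {x | (∃ i, i + 1 < n ∧ x ∈ segment ℝ (u i) (u (i + 1))) ∨
    (∃ i, i + 1 < n ∧ x ∈ segment ℝ (l i) (l (i + 1))) ∨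
    x ∈ segment ℝ (u 0) (l 0) ∨ x ∈ segment ℝ (u (n - 1)) (l (n - 1))}

theorem chainBoundary_comm (n : ℕ) (u l : ℕ → Plane) :
    chainBoundary n u l = chainBoundary n l u := by
  ext x
  simp only [chainBoundary, mem_ofPred_eq, segment_symm ℝ (u 0), segment_symm ℝ (u (n - 1))]
  exact or_left_comm

/-- A chain as a sequence indexed by all natural numbers, with the junk value `0` from `n` on. -/
noncomputable def chainExt {n : ℕ} (c : Fin n → Plane) (k : ℕ) : Plane :=
  if h : k < n then c ⟨k, h⟩ else 0

theorem chainExt_of_lt {n : ℕ} (c : Fin n → Plane) {k : ℕ} (h : k < n) :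
    chainExt c k = c ⟨k, h⟩ := dif_pos h

theorem doubleChainPolygon_lower {n : ℕ} (u l : Fin n → Plane) {k : ℕ} (h : k < n)
    (h' : k < n + n) : doubleChainPolygon u l ⟨k, h'⟩ = chainExt l k := by
  rw [chainExt_of_lt l h]
  exact Fin.append_left l (fun i => u i.rev) ⟨k, h⟩

theorem doubleChainPolygon_upper {n : ℕ} (u l : Fin n → Plane) {k : ℕ} (h : k < n)
    (h' : n + (n - 1 - k) < n + n) :
    doubleChainPolygon u l ⟨n + (n - 1 - k), h'⟩ = chainExt u k := by
  rw [chainExt_of_lt u h]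
  refine (Fin.append_right l (fun i => u i.rev) ⟨n - 1 - k, by omega⟩).trans ?_
  congr 1
  ext
  simp only [Fin.val_rev]
  omega

theorem finRotate_mk {m k : ℕ} (h : k < m) (h' : k + 1 < m) :
    finRotate m ⟨k, h⟩ = ⟨k + 1, h'⟩ := by
  obtain ⟨m, rfl⟩ : ∃ m', m = m' + 1 := ⟨m - 1, by omega⟩
  exact finRotate_of_lt (by omega)

theorem finRotate_mk_last {m k : ℕ} (h : k < m) (h' : k + 1 = m) :
    finRotate m ⟨k, h⟩ = ⟨0, by omega⟩ := by
  subst h'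
  exact finRotate_last'

theorem edgeSet_lower {n : ℕ} (u l : Fin n → Plane) {k : ℕ} (h : k + 1 < n) :
    (doubleChainPolygon u l).edgeSet ℝ ⟨k, by omega⟩ =
      segment ℝ (chainExt l k) (chainExt l (k + 1)) := by
  rw [edgeSet_eq_segment, finRotate_mk _ (by omega), doubleChainPolygon_lower u l (by omega),
    doubleChainPolygon_lower u l h]

theorem edgeSet_right {n : ℕ} (u l : Fin n → Plane) (h : 0 < n) :
    (doubleChainPolygon u l).edgeSet ℝ ⟨n - 1, by omega⟩ =
      segment ℝ (chainExt l (n - 1)) (chainExt u (n - 1)) := by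
  rw [edgeSet_eq_segment, finRotate_mk _ (by omega), doubleChainPolygon_lower u l (by omega),
    ← doubleChainPolygon_upper u l (k := n - 1) (by omega) (by omega)]
  congr 3
  omega

theorem edgeSet_upper {n : ℕ} (u l : Fin n → Plane) {k : ℕ} (h : k + 1 < n) :
    (doubleChainPolygon u l).edgeSet ℝ ⟨n + (n - 1 - (k + 1)), by omega⟩ =
      segment ℝ (chainExt u (k + 1)) (chainExt u k) := by
  rw [edgeSet_eq_segment, finRotate_mk _ (by omega), doubleChainPolygon_upper u l h,
    ← doubleChainPolygon_upper u l (k := k) (by omega) (by omega)]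
  congr 3
  omega

theorem edgeSet_left {n : ℕ} (u l : Fin n → Plane) (h : 0 < n) :
    (doubleChainPolygon u l).edgeSet ℝ ⟨n + (n - 1 - 0), by omega⟩ =
      segment ℝ (chainExt u 0) (chainExt l 0) := by
  rw [edgeSet_eq_segment, finRotate_mk_last _ (by omega), doubleChainPolygon_upper u l h,
    doubleChainPolygon_lower u l h]

theorem boundary_doubleChainPolygon {n : ℕ} (hn : 0 < n) (u l : Fin n → Plane) :
    (doubleChainPolygon u l).boundary ℝ = chainBoundary n (chainExt u) (chainExt l) := by
  ext x
  constructor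
  · intro hx
    obtain ⟨⟨k, hk⟩, hx⟩ := mem_iUnion.1 hx
    by_cases h1 : k + 1 < n
    · rw [edgeSet_lower u l h1] at hx
      exact Or.inr (Or.inl ⟨k, h1, hx⟩)
    by_cases h2 : k = n - 1
    · subst h2
      rw [edgeSet_right u l hn, segment_symm] at hx
      exact Or.inr (Or.inr (Or.inr hx))
    by_cases h3 : k = n + (n - 1 - 0)
    · subst h3
      rw [edgeSet_left u l hn] at hx
      exact Or.inr (Or.inr (Or.inl hx))
    · obtain ⟨i, hi, rfl⟩ : ∃ i, i + 1 < n ∧ k = n + (n - 1 - (i + 1)) :=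
        ⟨n + n - 2 - k, by omega, by omega⟩
      rw [edgeSet_upper u l hi, segment_symm] at hx
      exact Or.inl ⟨i, hi, hx⟩
  · rintro (⟨i, hi, hx⟩ | ⟨i, hi, hx⟩ | hx | hx)
    · rw [segment_symm, ← edgeSet_upper u l hi] at hx
      exact edgeSet_subset_boundary _ _ hx
    · rw [← edgeSet_lower u l hi] at hx
      exact edgeSet_subset_boundary _ _ hx
    · rw [← edgeSet_left u l hn] at hx
      exact edgeSet_subset_boundary _ _ hx
    · rw [segment_symm, ← edgeSet_right u l hn] at hx
      exact edgeSet_subset_boundary _ _ hx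

theorem range_doubleChainPolygon {n : ℕ} (u l : Fin n → Plane) :
    Set.range (doubleChainPolygon u l).vertices =
      {x | (∃ k < n, x = chainExt u k) ∨ ∃ k < n, x = chainExt l k} := by
  ext x
  constructor
  · rintro ⟨⟨k, hk⟩, rfl⟩
    by_cases h : k < n
    · exact Or.inr ⟨k, h, doubleChainPolygon_lower u l h hk⟩
    · obtain ⟨i, hi, rfl⟩ : ∃ i, i < n ∧ k = n + (n - 1 - i) := ⟨n + n - 1 - k, by omega, by omega⟩
      exact Or.inl ⟨i, hi, doubleChainPolygon_upper u l hi hk⟩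
  · rintro (⟨k, hk, rfl⟩ | ⟨k, hk, rfl⟩)
    · exact ⟨_, doubleChainPolygon_upper u l hk (by omega)⟩
    · exact ⟨_, doubleChainPolygon_lower u l hk (by omega)⟩

theorem IsDoubleChain.exists_chainPair {n : ℕ} (hn : 3 ≤ n) {u l : Fin n → Plane}
    (hD : IsDoubleChain u l) : ∃ σ, ChainPair n σ (chainExt u) (chainExt l) := by
  obtain ⟨T, hT1, hT2⟩ := exists_sign_of_reflex hn (u := chainExt u) (l := chainExt l) (by
    intro a b c k hab hbc hc hk
    rw [chainExt_of_lt u hc, chainExt_of_lt u (hab.trans (hbc.trans hc)),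
      chainExt_of_lt u (hbc.trans hc), chainExt_of_lt l hk]
    exact hD.upper_nonconvex _ _ _ _ hab hbc)
  obtain ⟨S, hS1, hS2⟩ := exists_sign_of_reflex hn (u := chainExt l) (l := chainExt u) (by
    intro a b c k hab hbc hc hk
    rw [chainExt_of_lt l hc, chainExt_of_lt l (hab.trans (hbc.trans hc)),
      chainExt_of_lt l (hbc.trans hc), chainExt_of_lt u hk]
    exact hD.lower_nonconvex _ _ _ _ hab hbc)
  have hT0 : T ≠ 0 := by
    rintro rfl
    simpa using hT1 0 1 0 (by omega) (by omega) (by omega)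
  have hS0 : S ≠ 0 := by
    rintro rfl
    simpa using hS1 0 1 0 (by omega) (by omega) (by omega)
  have hTS : T * S < 0 := by
    by_contra! hTS
    have hTS : 0 < T * S := lt_of_le_of_ne hTS (mul_ne_zero hT0 hS0).symm
    -- the two edges that join the chains would cross
    obtain ⟨x, hx1, hx2⟩ : (segment ℝ (chainExt u 0) (chainExt l 0) ∩
        segment ℝ (chainExt l (n - 1)) (chainExt u (n - 1))).Nonempty := by
      have a1 := hT1 0 (n - 1) 0 (by omega) (by omega) (by omega)
      have a2 := hT1 0 (n - 1) (n - 1) (by omega) (by omega) (by omega)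
      have b1 := hS1 0 (n - 1) 0 (by omega) (by omega) (by omega)
      have b2 := hS1 0 (n - 1) (n - 1) (by omega) (by omega) (by omega)
      set u0 := chainExt u 0
      set u1 := chainExt u (n - 1)
      set l0 := chainExt l 0
      set l1 := chainExt l (n - 1)
      have hT2 : 0 < T ^ 2 := by positivity
      have aux : ∀ x y : ℝ, 0 < T * x → 0 < S * y → 0 < x * y := by
        intro x y hx hy
        have := mul_pos hx hy
        have h2 : 0 < (T * S) * (x * y) := by nlinarith
        exact (mul_pos_iff_of_pos_left hTS).1 h2
      apply segments_inter_nonempty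
      · have e : orient u0 l0 l1 = orient l0 l1 u0 := (orient_rotate _ _ _).symm
        have e2 : orient u0 l0 u1 = -orient u0 u1 l0 := orient_swap_right _ _ _
        rw [e, e2]
        linarith [aux _ _ a1 b1]
      · have e : orient l1 u1 u0 = orient u0 u1 l1 * -1 := by
          simp only [orient]; ring
        have e2 : orient l1 u1 l0 = orient l0 l1 u1 := by rw [orient_rotate]
        rw [e, e2]
        linarith [aux _ _ a2 b2]
    rw [← edgeSet_left u l (by omega)] at hx1
    rw [← edgeSet_right u l (by omega)] at hx2
    have := (hD.simple.edge_inter _ _ (by simp; omega)).subset ⟨hx1, hx2⟩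
    rw [finRotate_mk_last _ (by omega), finRotate_mk _ (by omega)] at this
    have hinj := hD.simple.injective
    rcases this with ⟨rfl | rfl, h | h⟩ <;>
      · have := congrArg Fin.val (hinj h)
        simp at this <;> omega
  have aux : ∀ x : ℝ, 0 < S * x → T * x < 0 := by
    intro x hx
    rcases mul_neg_iff.1 hTS with ⟨h1, h2⟩ | ⟨h1, h2⟩ <;> nlinarith
  refine ⟨T, ⟨by omega, hT1, fun a b k h1 h2 h3 => aux _ (hS1 a b k h1 h2 h3), hT2,
    fun a b c h1 h2 h3 => ?_⟩⟩
  have := aux _ (by linarith [hS2 a b c h1 h2 h3] : 0 < S * -orient _ _ _)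
  linarith

open scoped Classical

/-! ### The fan triangulation of a double chain -/

/-- A point of a triangle is an interior point or lies on a side. -/
theorem triangle_cases {k : ℝ} {p q r x : Plane} (h : 0 < k * orient p q r)
    (hx : x ∈ convexHull ℝ ({p, q, r} : Set Plane)) :
    convexHull ℝ ({p, q, r} : Set Plane) ∈ 𝓝 x ∨
      x ∈ segment ℝ p q ∨ x ∈ segment ℝ q r ∨ x ∈ segment ℝ r p := by
  have h1 : 0 < k * orient q r p := by rwa [orient_rotate]
  have h2 : 0 < k * orient r p q := by rwa [orient_rotate]
  have e1 : ({p, q, r} : Set Plane) = {q, r, p} := by ext; simp; tauto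
  have e2 : ({p, q, r} : Set Plane) = {r, p, q} := by ext; simp; tauto
  obtain ⟨a, b, c⟩ := (mem_triangle_iff h).1 hx
  rcases a.eq_or_lt with a | a
  · exact Or.inr (Or.inl (mem_segment_of_mem_triangle h hx a.symm))
  rcases b.eq_or_lt with b | b
  · exact Or.inr (Or.inr (Or.inl (mem_segment_of_mem_triangle h1 (e1 ▸ hx) b.symm)))
  rcases c.eq_or_lt with c | c
  · exact Or.inr (Or.inr (Or.inr (mem_segment_of_mem_triangle h2 (e2 ▸ hx) c.symm)))
  left
  have c1 : Continuous fun y => k * orient p q y := by fun_prop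
  have c2 : Continuous fun y => k * orient q r y := by fun_prop
  have c3 : Continuous fun y => k * orient r p y := by fun_prop
  filter_upwards [c1.continuousAt.eventually (lt_mem_nhds a),
    c2.continuousAt.eventually (lt_mem_nhds b), c3.continuousAt.eventually (lt_mem_nhds c)]
    with y y1 y2 y3
  exact (mem_triangle_iff h).2 ⟨y1.le, y2.le, y3.le⟩

/-- Two triangles on different sides of a common edge cover a neighbourhood of its inner points. -/
theorem mem_nhds_of_two_triangles {k : ℝ} {p q w w' x : Plane} {F : Set Plane}
    (hw : 0 < k * orient p q w) (hw' : k * orient p q w' < 0) (hx : x ∈ openSegment ℝ p q)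
    (hF : convexHull ℝ ({p, q, w} : Set Plane) ⊆ F)
    (hF' : convexHull ℝ ({p, q, w'} : Set Plane) ⊆ F) : F ∈ 𝓝 x := by
  filter_upwards [eventually_mem_triangle hw hx,
    eventually_mem_triangle (k := -k) (by linarith) hx] with y h1 h2
  rcases le_total 0 (k * orient p q y) with h | h
  · exact hF (h1 h)
  · exact hF' (h2 (by linarith))

theorem orient_midpoint (a b p q : Plane) :
    orient a b (midpoint ℝ p q) = (orient a b p + orient a b q) / 2 := by
  rw [midpoint_eq_smul_add, smul_add, orient_combo (by norm_num)]
  norm_num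
  ring

/-- The points of the two chains. -/
def chainPoints (n : ℕ) (u l : ℕ → Plane) : Set Plane :=
  {x | (∃ k < n, x = u k) ∨ ∃ k < n, x = l k}

theorem chainPoints_comm (n : ℕ) (u l : ℕ → Plane) : chainPoints n u l = chainPoints n l u := by
  ext x
  exact or_comm

/-- The corners of the `k`-th triangle of the fan. It lies between the diagonals `k` and `k + 1`,
where the diagonals are `u 0, l 0` up to `u 0, l (n - 1)`, followed by `u 1, l (n - 1)` up to
`u (n - 1), l (n - 1)`: truncated subtraction and `min` describe both parts at once. -/
noncomputable def fanTriangle (n : ℕ) (u l : ℕ → Plane) (k : ℕ) : Finset Plane :=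
  {u (k - (n - 1)), l (min k (n - 1)), u (k + 1 - (n - 1)), l (min (k + 1) (n - 1))}

/-- The union of the triangles of the fan. -/
def fanSpace (n : ℕ) (u l : ℕ → Plane) : Set Plane :=
  ⋃ k ∈ Finset.range (2 * (n - 1)), convexHull ℝ (fanTriangle n u l k : Set Plane)

theorem mem_fanSpace {n : ℕ} {u l : ℕ → Plane} {x : Plane} : x ∈ fanSpace n u l ↔
    ∃ k < 2 * (n - 1), x ∈ convexHull ℝ (fanTriangle n u l k : Set Plane) := by
  simp [fanSpace]

theorem fanTriangle_lower {n k : ℕ} (u l : ℕ → Plane) (h : k + 1 < n) :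
    (fanTriangle n u l k : Set Plane) = {u 0, l k, l (k + 1)} := by
  have e1 : k - (n - 1) = 0 := by omega
  have e2 : min k (n - 1) = k := by omega
  have e3 : k + 1 - (n - 1) = 0 := by omega
  have e4 : min (k + 1) (n - 1) = k + 1 := by omega
  rw [fanTriangle, e1, e2, e3, e4]
  ext x
  simp
  tauto

theorem fanTriangle_upper {n k : ℕ} (u l : ℕ → Plane) (h : k + 1 < n) :
    (fanTriangle n u l (n - 1 + k) : Set Plane) = {u k, l (n - 1), u (k + 1)} := by
  have e1 : n - 1 + k - (n - 1) = k := by omega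
  have e2 : min (n - 1 + k) (n - 1) = n - 1 := by omega
  have e3 : n - 1 + k + 1 - (n - 1) = k + 1 := by omega
  have e4 : min (n - 1 + k + 1) (n - 1) = n - 1 := by omega
  rw [fanTriangle, e1, e2, e3, e4]
  ext x
  simp
  tauto

/-- The triangles of the fan, listed by the chain edges that they contain. -/
theorem fan_cases {n k : ℕ} (h : k < 2 * (n - 1)) :
    k + 1 < n ∨ ∃ i, i + 1 < n ∧ k = n - 1 + i := by
  by_cases hk : k + 1 < n
  · exact Or.inl hk
  · exact Or.inr ⟨k - (n - 1), by omega, by omega⟩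

theorem triangle_lower_subset_fanSpace {n k : ℕ} (u l : ℕ → Plane) (h : k + 1 < n) :
    convexHull ℝ {u 0, l k, l (k + 1)} ⊆ fanSpace n u l := fun x hx =>
  mem_fanSpace.2 ⟨k, by omega, by rwa [fanTriangle_lower u l h]⟩

theorem triangle_upper_subset_fanSpace {n k : ℕ} (u l : ℕ → Plane) (h : k + 1 < n) :
    convexHull ℝ {u k, l (n - 1), u (k + 1)} ⊆ fanSpace n u l := fun x hx =>
  mem_fanSpace.2 ⟨n - 1 + k, by omega, by rwa [fanTriangle_upper u l h]⟩

theorem u_mem_chainBoundary {n k : ℕ} (hn : 2 ≤ n) (u l : ℕ → Plane) (h : k < n) :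
    u k ∈ chainBoundary n u l := by
  by_cases hk : k + 1 < n
  · exact Or.inl ⟨k, hk, left_mem_segment _ _ _⟩
  · obtain ⟨i, rfl⟩ : ∃ i, k = i + 1 := ⟨k - 1, by omega⟩
    exact Or.inl ⟨i, h, right_mem_segment _ _ _⟩

theorem l_mem_chainBoundary {n k : ℕ} (hn : 2 ≤ n) (u l : ℕ → Plane) (h : k < n) :
    l k ∈ chainBoundary n u l := by
  rw [chainBoundary_comm]
  exact u_mem_chainBoundary hn l u h

theorem mem_openSegment_of_not_mem {B : Set Plane} {p q x : Plane} (hp : p ∈ B) (hq : q ∈ B)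
    (hx : x ∉ B) (h : x ∈ segment ℝ p q) : x ∈ openSegment ℝ p q := by
  rw [← insert_endpoints_openSegment] at h
  rcases h with rfl | rfl | h
  · exact absurd hp hx
  · exact absurd hq hx
  · exact h

theorem isCompact_fanSpace (n : ℕ) (u l : ℕ → Plane) : IsCompact (fanSpace n u l) :=
  (Finset.range _).isCompact_biUnion fun _ _ => (Finset.finite_toSet _).isCompact_convexHull ℝ

theorem chainBoundary_subset_fanSpace {n : ℕ} (hn : 2 ≤ n) (u l : ℕ → Plane) :
    chainBoundary n u l ⊆ fanSpace n u l := by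
  have seg : ∀ {s : Set Plane} {p q x : Plane}, p ∈ s → q ∈ s → x ∈ segment ℝ p q →
      x ∈ convexHull ℝ s := fun hp hq hx => segment_subset_convexHull hp hq hx
  rintro x (⟨i, hi, hx⟩ | ⟨i, hi, hx⟩ | hx | hx)
  · exact triangle_upper_subset_fanSpace u l hi (seg (by simp) (by simp) hx)
  · exact triangle_lower_subset_fanSpace u l hi (seg (by simp) (by simp) hx)
  · exact triangle_lower_subset_fanSpace u l (k := 0) (by omega) (seg (by simp) (by simp) hx)
  · obtain ⟨m, rfl⟩ : ∃ m, n = m + 2 := ⟨n - 2, by omega⟩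
    exact triangle_upper_subset_fanSpace u l (k := m) (by omega) (seg (by simp) (by simp) hx)

namespace ChainPair

variable {n : ℕ} {σ : ℝ} {u l : ℕ → Plane}

/-- The union of the fan has no frontier points besides the boundary of the double chain polygon. -/
theorem fanSpace_mem_nhds (H : ChainPair n σ u l) {x : Plane} (hx : x ∈ fanSpace n u l)
    (hxB : x ∉ chainBoundary n u l) : fanSpace n u l ∈ 𝓝 x := by
  have hn := H.two_le
  have hu : ∀ k < n, u k ∈ chainBoundary n u l := fun k hk => u_mem_chainBoundary hn u l hk
  have hl : ∀ k < n, l k ∈ chainBoundary n u l := fun k hk => l_mem_chainBoundary hn u l hk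
  -- the three kinds of inner diagonals
  have d1 : ∀ k, 0 < k → k + 1 < n → x ∈ segment ℝ (u 0) (l k) → fanSpace n u l ∈ 𝓝 x := by
    intro k h0 hk hx
    obtain ⟨j, rfl⟩ : ∃ j, k = j + 1 := ⟨k - 1, by omega⟩
    refine mem_nhds_of_two_triangles
      (H.diag_l_gt (i := 0) (Nat.lt_succ_self j) (by omega) (by omega))
      (H.diag_l_lt (Nat.lt_succ_self (j + 1)) hk (by omega))
      (mem_openSegment_of_not_mem (hu _ (by omega)) (hl _ (by omega)) hxB hx) ?_
      (triangle_lower_subset_fanSpace u l hk)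
    rw [Set.pair_comm (l (j + 1))]
    exact triangle_lower_subset_fanSpace u l (by omega)
  have d2 : x ∈ segment ℝ (u 0) (l (n - 1)) → fanSpace n u l ∈ 𝓝 x := by
    intro hx
    obtain ⟨j, rfl⟩ : ∃ j, n = j + 2 := ⟨n - 2, by omega⟩
    refine mem_nhds_of_two_triangles
      (H.diag_l_gt (i := 0) (Nat.lt_succ_self j) (by omega) (by omega))
      (H.diag_u_lt (Nat.lt_succ_self 0) (by omega) (by omega))
      (mem_openSegment_of_not_mem (hu _ (by omega)) (hl _ (by omega)) hxB hx) ?_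
      (triangle_upper_subset_fanSpace u l (n := j + 2) (k := 0) (by omega))
    rw [Set.pair_comm (l (j + 1))]
    exact triangle_lower_subset_fanSpace u l (by omega)
  have d3 : ∀ k, 0 < k → k + 1 < n → x ∈ segment ℝ (u k) (l (n - 1)) → fanSpace n u l ∈ 𝓝 x := by
    intro k h0 hk hx
    obtain ⟨j, rfl⟩ : ∃ j, k = j + 1 := ⟨k - 1, by omega⟩
    refine mem_nhds_of_two_triangles (H.diag_u_gt (Nat.lt_succ_self j) (by omega) (by omega))
      (H.diag_u_lt (Nat.lt_succ_self (j + 1)) hk (by omega))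
      (mem_openSegment_of_not_mem (hu _ (by omega)) (hl _ (by omega)) hxB hx) ?_
      (triangle_upper_subset_fanSpace u l hk)
    refine Subset.trans (convexHull_mono ?_) (triangle_upper_subset_fanSpace u l
      (show j + 1 < n by omega))
    intro z
    simp
    tauto
  obtain ⟨k, hk, hx⟩ := mem_fanSpace.1 hx
  rcases fan_cases hk with h | ⟨i, h, rfl⟩
  · rw [fanTriangle_lower u l h] at hx
    have ho := H.diag_l_lt (i := 0) (Nat.lt_succ_self k) h (by omega)
    rcases triangle_cases (k := -σ) (by linarith) hx with h1 | h1 | h1 | h1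
    · exact mem_of_superset h1 (triangle_lower_subset_fanSpace u l h)
    · rcases Nat.eq_zero_or_pos k with rfl | h0
      · exact absurd (Or.inr (Or.inr (Or.inl h1))) hxB
      · exact d1 k h0 h h1
    · exact absurd (Or.inr (Or.inl ⟨k, h, h1⟩)) hxB
    · rw [segment_symm] at h1
      by_cases hk' : k + 1 + 1 < n
      · exact d1 (k + 1) (by omega) hk' h1
      · obtain rfl : n = k + 2 := by omega
        exact d2 h1
  · rw [fanTriangle_upper u l h] at hx
    have ho := H.diag_u_lt (j := n - 1) (Nat.lt_succ_self i) h (by omega)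
    rcases triangle_cases (k := -σ) (by linarith) hx with h1 | h1 | h1 | h1
    · exact mem_of_superset h1 (triangle_upper_subset_fanSpace u l h)
    · rcases Nat.eq_zero_or_pos i with rfl | h0
      · exact d2 h1
      · exact d3 i h0 h h1
    · rw [segment_symm] at h1
      by_cases hk' : i + 1 + 1 < n
      · exact d3 (i + 1) (by omega) hk' h1
      · obtain rfl : n = i + 2 := by omega
        exact absurd (Or.inr (Or.inr (Or.inr h1))) hxB
    · rw [segment_symm] at h1
      exact absurd (Or.inl ⟨i, h, h1⟩) hxB

/-- The region of a double chain polygon is the union of the triangles of the fan. -/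
theorem region_eq_fanSpace (H : ChainPair n σ u l) {m : ℕ} {P : Polygon Plane m}
    (hP : IsSimple P) (hB : P.boundary ℝ = chainBoundary n u l)
    (he : ∃ e, s(P e, P (finRotate m e)) = s(l 0, l 1)) : region P = fanSpace n u l := by
  have hn := H.two_le
  have ho := H.llu 0 1 0 (by omega) (by omega) (by omega)
  have hopen : IsOpen (fanSpace n u l \ P.boundary ℝ) := by
    rw [isOpen_iff_mem_nhds]
    rintro x ⟨hx, hxB⟩
    exact inter_mem (H.fanSpace_mem_nhds hx (hB ▸ hxB))
      ((isCompact_boundary P).isClosed.isOpen_compl.mem_nhds hxB)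
  have hBF : P.boundary ℝ ⊆ fanSpace n u l := hB ▸ chainBoundary_subset_fanSpace hn u l
  have htri : convexHull ℝ {l 0, l 1, u 0} ⊆ fanSpace n u l := by
    refine Subset.trans (convexHull_mono ?_) (triangle_lower_subset_fanSpace u l
      (show 0 + 1 < n by omega))
    intro z
    simp
    tauto
  have hc := isCompact_fanSpace n u l
  obtain ⟨e, he⟩ := he
  rcases Sym2.eq_iff.1 he with ⟨h0, h1⟩ | ⟨h0, h1⟩
  · refine hP.region_eq hc.isClosed hc.isBounded hBF hopen (i := e) (midpoint_mem_openSegment _ _)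
      (neg_ne_zero.2 H.sign_ne_zero) ?_
    rw [h0, h1]
    filter_upwards [eventually_mem_triangle (k := -σ) (r := u 0) (by linarith)
      (midpoint_mem_openSegment (l 0) (l 1))] with y hy hy0
    exact htri (hy hy0)
  · refine hP.region_eq hc.isClosed hc.isBounded hBF hopen (i := e) (midpoint_mem_openSegment _ _)
      H.sign_ne_zero ?_
    rw [h0, h1, midpoint_comm]
    filter_upwards [eventually_mem_triangle (k := -σ) (r := u 0) (by linarith)
      (midpoint_mem_openSegment (l 0) (l 1))] with y hy hy0
    rw [orient_swap_left] at hy0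
    exact htri (hy (by linarith))

theorem diag_u_nonneg (H : ChainPair n σ u l) {i j k : ℕ} (hik : k ≤ i) (hi : i < n) (hj : j < n) :
    0 ≤ σ * orient (u i) (l j) (u k) := by
  rcases hik.eq_or_lt with rfl | h
  · simp
  · exact (H.diag_u_gt h hi hj).le

theorem diag_u_nonpos (H : ChainPair n σ u l) {i j k : ℕ} (hik : i ≤ k) (hk : k < n) (hj : j < n) :
    σ * orient (u i) (l j) (u k) ≤ 0 := by
  rcases hik.eq_or_lt with rfl | h
  · simp
  · exact (H.diag_u_lt h hk hj).le

theorem diag_l_nonneg (H : ChainPair n σ u l) {i j k : ℕ} (hjk : k ≤ j) (hj : j < n) (hi : i < n) :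
    0 ≤ σ * orient (u i) (l j) (l k) := by
  rcases hjk.eq_or_lt with rfl | h
  · simp
  · exact (H.diag_l_gt h hj hi).le

theorem diag_l_nonpos (H : ChainPair n σ u l) {i j k : ℕ} (hjk : j ≤ k) (hk : k < n) (hi : i < n) :
    σ * orient (u i) (l j) (l k) ≤ 0 := by
  rcases hjk.eq_or_lt with rfl | h
  · simp
  · exact (H.diag_l_lt h hk hi).le

theorem diag_eq_zero (H : ChainPair n σ u l) {i j : ℕ} (hi : i < n) (hj : j < n) {y : Plane}
    (hy : y ∈ chainPoints n u l) (h0 : σ * orient (u i) (l j) y = 0) : y = u i ∨ y = l j := by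
  rcases hy with ⟨k, hk, rfl⟩ | ⟨k, hk, rfl⟩
  · rcases lt_trichotomy i k with h | rfl | h
    · exact absurd h0 (H.diag_u_lt h hk hj).ne
    · exact Or.inl rfl
    · exact absurd h0 (H.diag_u_gt h hi hj).ne'
  · rcases lt_trichotomy j k with h | rfl | h
    · exact absurd h0 (H.diag_l_lt h hk hi).ne
    · exact Or.inr rfl
    · exact absurd h0 (H.diag_l_gt h hj hi).ne'

end ChainPair

theorem mem_fanTriangle {n k : ℕ} {u l : ℕ → Plane} {x : Plane} : x ∈ fanTriangle n u l k ↔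
    x = u (k - (n - 1)) ∨ x = l (min k (n - 1)) ∨ x = u (k + 1 - (n - 1)) ∨
      x = l (min (k + 1) (n - 1)) := by
  simp [fanTriangle]

theorem fanTriangle_subset {n k : ℕ} {u l : ℕ → Plane} (hk : k < 2 * (n - 1)) {x : Plane}
    (hx : x ∈ fanTriangle n u l k) : x ∈ chainPoints n u l := by
  rcases mem_fanTriangle.1 hx with rfl | rfl | rfl | rfl
  · exact Or.inl ⟨_, by omega, rfl⟩
  · exact Or.inr ⟨_, by omega, rfl⟩
  · exact Or.inl ⟨_, by omega, rfl⟩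
  · exact Or.inr ⟨_, by omega, rfl⟩

theorem ChainPair.fan_indep {n : ℕ} {σ : ℝ} {u l : ℕ → Plane} (H : ChainPair n σ u l) {k : ℕ}
    (hk : k < 2 * (n - 1)) {s : Finset Plane} (hs : s ⊆ fanTriangle n u l k) :
    AffineIndependent ℝ ((↑) : s → Plane) := by
  have hs' : (s : Set Plane) ⊆ fanTriangle n u l k := by exact_mod_cast hs
  rcases fan_cases hk with h | ⟨i, h, rfl⟩
  · rw [fanTriangle_lower u l h] at hs'
    refine affineIndependent_subset_triangle (fun h0 => ?_) hs'
    have := H.diag_l_lt (i := 0) (Nat.lt_succ_self k) h (by omega)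
    rw [h0] at this; simp at this
  · rw [fanTriangle_upper u l h] at hs'
    refine affineIndependent_subset_triangle (fun h0 => ?_) hs'
    have := H.diag_u_lt (j := n - 1) (Nat.lt_succ_self i) h (by omega)
    rw [h0] at this; simp at this

theorem ChainPair.fan_inter_of_lt {n : ℕ} {σ : ℝ} {u l : ℕ → Plane} (H : ChainPair n σ u l)
    {k k' : ℕ} (hkk : k < k') (hk' : k' < 2 * (n - 1)) {s t : Finset Plane}
    (hs : s ⊆ fanTriangle n u l k) (ht : t ⊆ fanTriangle n u l k') :
    convexHull ℝ (s : Set Plane) ∩ convexHull ℝ (t : Set Plane) ⊆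
      convexHull ℝ ((s : Set Plane) ∩ t) := by
  -- the diagonal `k + 1` separates the two triangles
  have hi : k + 1 - (n - 1) < n := by omega
  have hj : min (k + 1) (n - 1) < n := by omega
  refine convexHull_inter_subset_of_separated (k := σ) (H.u_ne_l hi hj) ?_ ?_ ?_ ?_
  · intro y hy
    rcases mem_fanTriangle.1 (hs hy) with rfl | rfl | rfl | rfl
    · exact H.diag_u_nonneg (by omega) hi hj
    · exact H.diag_l_nonneg (by omega) hj hi
    · simp
    · simp
  · intro y hy
    rcases mem_fanTriangle.1 (ht hy) with rfl | rfl | rfl | rfl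
    · exact H.diag_u_nonpos (by omega) (by omega) hj
    · exact H.diag_l_nonpos (by omega) (by omega) hi
    · exact H.diag_u_nonpos (by omega) (by omega) hj
    · exact H.diag_l_nonpos (by omega) (by omega) hi
  · exact fun y hy h0 => H.diag_eq_zero hi hj (fanTriangle_subset (by omega) (hs hy)) h0
  · exact fun y hy h0 => H.diag_eq_zero hi hj (fanTriangle_subset hk' (ht hy)) h0

/-- The triangulation of a double chain polygon by the triangles that join `u 0` to the edges of
`l` and `l (n - 1)` to the edges of `u`. -/
noncomputable def fanComplex {n : ℕ} {σ : ℝ} {u l : ℕ → Plane} (H : ChainPair n σ u l) :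
    SimplicialComplex ℝ Plane where
  faces := {s | s.Nonempty ∧ ∃ k < 2 * (n - 1), s ⊆ fanTriangle n u l k}
  isRelLowerSet_faces := by
    rintro s ⟨hs, k, hk, hsk⟩
    exact ⟨hs, fun t hts ht => ⟨ht, k, hk, hts.trans hsk⟩⟩
  indep := by
    rintro s ⟨-, k, hk, hs⟩
    exact H.fan_indep hk hs
  inter_subset_convexHull := by
    rintro s t ⟨-, k, hk, hs⟩ ⟨-, k', hk', ht⟩
    rcases lt_trichotomy k k' with h | rfl | h
    · exact H.fan_inter_of_lt h hk' hs ht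
    · exact ((H.fan_indep hk subset_rfl).convexHull_inter hs ht).symm.subset
    · rw [inter_comm (convexHull ℝ _), inter_comm (s : Set Plane)]
      exact H.fan_inter_of_lt h hk ht hs

theorem mem_faces_fanComplex {n : ℕ} {σ : ℝ} {u l : ℕ → Plane} (H : ChainPair n σ u l)
    {s : Finset Plane} : s ∈ (fanComplex H).faces ↔
      s.Nonempty ∧ ∃ k < 2 * (n - 1), s ⊆ fanTriangle n u l k := Iff.rfl

theorem space_fanComplex {n : ℕ} {σ : ℝ} {u l : ℕ → Plane} (H : ChainPair n σ u l) :
    (fanComplex H).space = fanSpace n u l := by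
  ext x
  rw [SimplicialComplex.mem_space_iff, mem_fanSpace]
  constructor
  · rintro ⟨s, ⟨-, k, hk, hs⟩, hx⟩
    exact ⟨k, hk, convexHull_mono (by exact_mod_cast hs) hx⟩
  · rintro ⟨k, hk, hx⟩
    exact ⟨fanTriangle n u l k,
      ⟨⟨u (k - (n - 1)), mem_fanTriangle.2 (Or.inl rfl)⟩, k, hk, subset_rfl⟩, hx⟩

theorem vertices_fanComplex {n : ℕ} {σ : ℝ} {u l : ℕ → Plane} (H : ChainPair n σ u l) :
    (fanComplex H).vertices = chainPoints n u l := by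
  have hn := H.two_le
  ext x
  rw [SimplicialComplex.mem_vertices, mem_faces_fanComplex]
  constructor
  · rintro ⟨-, k, hk, hx⟩
    exact fanTriangle_subset hk (hx (Finset.mem_singleton_self x))
  · rintro (⟨k, hk, rfl⟩ | ⟨k, hk, rfl⟩)
    · refine ⟨Finset.singleton_nonempty _, n - 1 + k - 1, by omega, ?_⟩
      rw [Finset.singleton_subset_iff, mem_fanTriangle]
      exact Or.inr (Or.inr (Or.inl (by congr 1; omega)))
    · refine ⟨Finset.singleton_nonempty _, k, by omega, ?_⟩
      rw [Finset.singleton_subset_iff, mem_fanTriangle]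
      exact Or.inr (Or.inl (by congr 1; omega))

/-! ### The extreme triangulations of a double chain -/

namespace ChainPair

variable {n : ℕ} {σ : ℝ} {u l : ℕ → Plane}

/-- The fan has no points that are beyond the lines of all edges of the upper chain. -/
theorem exists_edge_u_nonneg (H : ChainPair n σ u l) {x : Plane} (hx : x ∈ fanSpace n u l) :
    ∃ i, i + 1 < n ∧ 0 ≤ σ * orient (u i) (u (i + 1)) x := by
  have hn := H.two_le
  obtain ⟨k, hk, hx⟩ := mem_fanSpace.1 hx
  rcases fan_cases hk with h | ⟨i, h, rfl⟩
  · rw [fanTriangle_lower u l h] at hx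
    refine ⟨0, by omega, orient_nonneg_of_mem_convexHull ?_ hx⟩
    rintro y (rfl | rfl | rfl)
    · simp
    · exact (H.uul _ _ _ (by omega) (by omega) (by omega)).le
    · exact (H.uul _ _ _ (by omega) (by omega) (by omega)).le
  · rw [fanTriangle_upper u l h] at hx
    refine ⟨i, h, orient_nonneg_of_mem_convexHull ?_ hx⟩
    rintro y (rfl | rfl | rfl)
    · simp
    · exact (H.uul _ _ _ (by omega) (by omega) (by omega)).le
    · simp

/-- The fan has no points that are beyond the lines of all edges of the lower chain. -/
theorem exists_edge_l_nonpos (H : ChainPair n σ u l) {x : Plane} (hx : x ∈ fanSpace n u l) :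
    ∃ i, i + 1 < n ∧ 0 ≤ (-σ) * orient (l i) (l (i + 1)) x := by
  have hn := H.two_le
  obtain ⟨k, hk, hx⟩ := mem_fanSpace.1 hx
  rcases fan_cases hk with h | ⟨i, h, rfl⟩
  · rw [fanTriangle_lower u l h] at hx
    refine ⟨k, h, orient_nonneg_of_mem_convexHull ?_ hx⟩
    rintro y (rfl | rfl | rfl)
    · linarith [H.llu k (k + 1) 0 (by omega) (by omega) (by omega)]
    · simp
    · simp
  · rw [fanTriangle_upper u l h] at hx
    obtain ⟨m, rfl⟩ : ∃ m, n = m + 2 := ⟨n - 2, by omega⟩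
    refine ⟨m, by omega, orient_nonneg_of_mem_convexHull ?_ hx⟩
    rintro y (rfl | rfl | rfl)
    · linarith [H.llu m (m + 1) i (by omega) (by omega) (by omega)]
    · simp
    · linarith [H.llu m (m + 1) (i + 1) (by omega) (by omega) (by omega)]

/-- An edge between two points of one chain joins consecutive points: all other such segments leave
the region. -/
theorem adjacent_of_mem_faces (H : ChainPair n σ u l) {K : SimplicialComplex ℝ Plane}
    (hK : ∀ x ∈ K.space, ∃ i, i + 1 < n ∧ 0 ≤ σ * orient (u i) (u (i + 1)) x) {a c : ℕ}
    (hac : a < c) (hc : c < n) (h : {u a, u c} ∈ K.faces) : c = a + 1 := by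
  by_contra hne
  have hx : midpoint ℝ (u a) (u c) ∈ K.space := by
    refine SimplicialComplex.convexHull_subset_space h ?_
    rw [Finset.coe_pair, convexHull_pair]
    exact midpoint_mem_segment _ _
  obtain ⟨i, hi, h0⟩ := hK _ hx
  rw [orient_midpoint] at h0
  have h1 := H.edge_u_nonpos hi (show a < n by omega)
  have h2 := H.edge_u_nonpos hi hc
  by_cases ha : a = i ∨ a = i + 1
  · have := H.edge_u hi hc (by omega) (by omega)
    linarith
  · have := H.edge_u hi (show a < n by omega) (by omega) (by omega)
    linarith

/-- Each edge of a chain lies in a triangle with its apex on the other chain: a face that contains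
the midpoint of the edge has corners on both sides of it in this chain. The hypothesis `hsub` makes
the space of `K` reach this edge from the inner side. -/
theorem exists_apex (H : ChainPair n σ u l) {K : SimplicialComplex ℝ Plane}
    (hK : ∀ x ∈ K.space, ∃ i, i + 1 < n ∧ 0 ≤ σ * orient (u i) (u (i + 1)) x)
    (hV : K.vertices = chainPoints n u l) {i j : ℕ} (hi : i + 1 < n) (hj : j < n)
    (hsub : convexHull ℝ {u i, u (i + 1), l j} ⊆ K.space) :
    ∃ k < n, {u i, u (i + 1), l k} ∈ K.faces := by
  have hn := H.two_le
  have hpq : u i ≠ u (i + 1) := fun h => by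
    have := H.u_injective (by omega) hi h
    omega
  have hVf : K.vertices.Finite := by
    rw [hV]
    refine (((Set.finite_Iio n).image u).union ((Set.finite_Iio n).image l)).subset ?_
    rintro x (⟨k, hk, rfl⟩ | ⟨k, hk, rfl⟩)
    · exact Or.inl ⟨k, hk, rfl⟩
    · exact Or.inr ⟨k, hk, rfl⟩
  have hmem : ∀ s ∈ K.faces, ∀ x ∈ s, x ∈ K.vertices := fun s hs x hx =>
    K.down_closed hs (Finset.singleton_subset_iff.2 hx) (Finset.singleton_nonempty x)
  have hfin : K.faces.Finite := by
    refine (hVf.toFinset.powerset.finite_toSet).subset fun s hs => ?_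
    simp only [Finset.coe_powerset, mem_preimage, mem_powerset_iff]
    exact fun x hx => hVf.coe_toFinset.symm.subset (hmem s hs x hx)
  set z := midpoint ℝ (u i) (u (i + 1)) with hzdef
  have hz := midpoint_mem_openSegment (u i) (u (i + 1))
  -- a face that contains the midpoint of the edge and a point off the edge
  have hclosed : IsClosed (⋃ s ∈ {s ∈ K.faces | z ∉ convexHull ℝ (s : Set Plane)},
      convexHull ℝ (s : Set Plane)) :=
    (hfin.subset (sep_subset _ _)).isClosed_biUnion fun s _ =>
      ((Finset.finite_toSet s).isCompact_convexHull ℝ).isClosed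
  have hznot : z ∉ ⋃ s ∈ {s ∈ K.faces | z ∉ convexHull ℝ (s : Set Plane)},
      convexHull ℝ (s : Set Plane) := by
    intro h
    obtain ⟨s, ⟨-, hs⟩, hzs⟩ := mem_iUnion₂.1 h
    exact hs hzs
  have hcl := mem_closure_side H.sign_ne_zero hpq isOpen_univ (mem_univ _)
    (mem_openSegment_orient hz)
  obtain ⟨y, ⟨-, hy⟩, hy1, hy2⟩ := ((mem_closure_iff_frequently.1 hcl).and_eventually
    ((eventually_mem_triangle (H.uul i (i + 1) j (by omega) hi hj) hz).and
      (hclosed.isOpen_compl.mem_nhds hznot))).exists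
  rw [mem_ofPred_eq] at hy
  obtain ⟨s, hs, hys⟩ := SimplicialComplex.mem_space_iff.1 (hsub (hy1 hy.le))
  have hzs : z ∈ convexHull ℝ (s : Set Plane) := by
    by_contra h
    exact hy2 (mem_iUnion₂.2 ⟨s, ⟨hs, h⟩, hys⟩)
  have hsV : ∀ x ∈ s, x ∈ chainPoints n u l := fun x hx => hV ▸ hmem s hs x hx
  obtain ⟨a, hai, has⟩ : ∃ a ≤ i, u a ∈ s := by
    by_contra! hno
    have h0 := H.diag_u_gt (j := 0) (Nat.lt_succ_self i) hi (by omega)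
    have := orient_nonneg_of_mem_convexHull (k := -σ) (p := u (i + 1)) (q := l 0) (fun x hx => ?_) hzs
    · rw [orient_midpoint, orient_self_outer] at this
      nlinarith
    · rcases hsV x hx with ⟨b, hb, rfl⟩ | ⟨b, hb, rfl⟩
      · have hbi : i + 1 ≤ b := by
          by_contra hlt
          exact hno b (by omega) hx
        linarith [H.diag_u_nonpos (j := 0) hbi hb (by omega)]
      · linarith [H.diag_l_nonpos (i := i + 1) (Nat.zero_le b) hb (by omega)]
  obtain ⟨c, hic, hcn, hcs⟩ : ∃ c, i + 1 ≤ c ∧ c < n ∧ u c ∈ s := by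
    by_contra! hno
    have h0 := H.diag_u_lt (j := n - 1) (Nat.lt_succ_self i) hi (by omega)
    have := orient_nonneg_of_mem_convexHull (k := σ) (p := u i) (q := l (n - 1)) (fun x hx => ?_) hzs
    · rw [orient_midpoint, orient_self_outer] at this
      nlinarith
    · rcases hsV x hx with ⟨b, hb, rfl⟩ | ⟨b, hb, rfl⟩
      · have hbi : b ≤ i := by
          by_contra hlt
          exact hno b (by omega) hb hx
        exact H.diag_u_nonneg hbi (by omega) (by omega)
      · exact H.diag_l_nonneg (by omega) (by omega) (by omega)
  have hpair : ∀ b d, u b ∈ s → u d ∈ s → b < d → d < n → d = b + 1 := by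
    intro b d hb hd hbd hdn
    refine H.adjacent_of_mem_faces hK hbd hdn (K.down_closed hs ?_ (by simp))
    intro x hx
    simp only [Finset.mem_insert, Finset.mem_singleton] at hx
    rcases hx with rfl | rfl <;> assumption
  have hca := hpair a c has hcs (by omega) hcn
  obtain rfl : a = i := by omega
  obtain rfl : c = a + 1 := hca
  obtain ⟨w, hws, hwa, hwc⟩ : ∃ w ∈ s, w ≠ u a ∧ w ≠ u (a + 1) := by
    by_contra! hno
    have : y ∈ segment ℝ (u a) (u (a + 1)) := by
      rw [← convexHull_pair]
      refine convexHull_mono (fun x hx => ?_) hys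
      by_cases hxa : x = u a
      · exact Or.inl hxa
      · exact Or.inr (hno x hx hxa)
    rw [orient_eq_zero_of_mem_segment this, mul_zero] at hy
    exact lt_irrefl _ hy
  rcases hsV w hws with ⟨b, hb, rfl⟩ | ⟨b, hb, rfl⟩
  · have hba : b ≠ a := fun h => hwa (by rw [h])
    have hbc : b ≠ a + 1 := fun h => hwc (by rw [h])
    rcases lt_or_gt_of_ne hba with h | h
    · have := hpair b (a + 1) hws hcs (by omega) hcn
      omega
    · have := hpair a b has hws h hb
      omega
  · refine ⟨b, hb, K.down_closed hs ?_ (by simp)⟩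
    intro x hx
    simp only [Finset.mem_insert, Finset.mem_singleton] at hx
    rcases hx with rfl | rfl | rfl <;> assumption

/-- The segments `u 0, l (n - 1)` and `u a, l j` cross. -/
theorem not_mem_faces_of_crossing (H : ChainPair n σ u l) {K : SimplicialComplex ℝ Plane}
    (h0 : {u 0, l (n - 1)} ∈ K.faces) {a j : ℕ} (ha : 0 < a) (han : a < n) (hj : j + 1 < n) :
    {u a, l j} ∉ K.faces := by
  intro h
  have hn := H.two_le
  have a1 := H.diag_u_lt (j := n - 1) ha han (by omega)
  have a2 := H.diag_l_gt (i := 0) (show j < n - 1 by omega) (by omega) (by omega)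
  have b1 := H.diag_u_gt (j := j) ha han (by omega)
  have b2 := H.diag_l_lt (i := a) (show j < n - 1 by omega) (by omega) (by omega)
  have hσ2 : 0 < σ ^ 2 := by have := H.sign_ne_zero; positivity
  have aux : ∀ x y : ℝ, σ * x < 0 → 0 < σ * y → x * y < 0 := by
    intro x y hx hy
    have := mul_neg_of_neg_of_pos hx hy
    by_contra! h
    nlinarith [mul_nonneg hσ2.le h]
  obtain ⟨x, hx1, hx2⟩ := segments_inter_nonempty (aux _ _ a1 a2)
    (by rw [mul_comm]; exact aux _ _ b2 b1)
  rw [← convexHull_pair, ← Finset.coe_pair] at hx1 hx2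
  have := K.inter_subset_convexHull h0 h ⟨hx1, hx2⟩
  rw [← Finset.coe_inter] at this
  have hempty : ({u 0, l (n - 1)} ∩ {u a, l j} : Finset Plane) = ∅ := by
    ext z
    simp only [Finset.mem_inter, Finset.mem_insert, Finset.mem_singleton, Finset.notMem_empty,
      iff_false, not_and, not_or]
    rintro (rfl | rfl)
    · exact ⟨fun h => by have := H.u_injective (by omega) han h; omega,
        H.u_ne_l (by omega) (by omega)⟩
    · exact ⟨(H.u_ne_l han (by omega)).symm,
        fun h => by have := H.symm.u_injective (by omega) (by omega) h; omega⟩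
  rw [hempty] at this
  simp at this

/-- A triangulation of the double chain with maximum degree at `u 0` consists of the triangles of
the fan: the fan gives `u 0` all neighbours that it can have, so `u 0, l (n - 1)` is an edge, and
this edge leaves no choice for the triangles at the edges of the chains. -/
theorem faces_of_isMaxDegree (H : ChainPair n σ u l) {m : ℕ} {P : Polygon Plane m}
    (hR : region P = fanSpace n u l) (hV : Set.range P.vertices = chainPoints n u l)
    {K : SimplicialComplex ℝ Plane} (hK : IsMaxDegreeTriangulation P (u 0) K) :
    (∀ i, i + 1 < n → {u i, u (i + 1), l (n - 1)} ∈ K.faces) ∧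
      ∀ i, i + 1 < n → {l i, l (i + 1), u 0} ∈ K.faces := by
  have hn := H.two_le
  have hKR : K.space = fanSpace n u l := hK.1.space_eq.trans hR
  have hKV : K.vertices = chainPoints n u l := hK.1.vertices_eq.trans hV
  set N : Set Plane := insert (u 1) (l '' Iio n) with hN
  have hNf : N.Finite := ((Set.finite_Iio n).image l).insert _
  have hnbr : {q | q ≠ u 0 ∧ {u 0, q} ∈ K.faces} ⊆ N := by
    rintro q ⟨hq0, hq⟩
    have hqV : q ∈ K.vertices := K.down_closed hq (by simp) (Finset.singleton_nonempty q)
    rw [hKV] at hqV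
    rcases hqV with ⟨k, hk, rfl⟩ | ⟨k, hk, rfl⟩
    · have hk0 : 0 < k := Nat.pos_of_ne_zero fun h => hq0 (by rw [h])
      have := H.adjacent_of_mem_faces (fun x hx => H.exists_edge_u_nonneg (hKR ▸ hx)) hk0 hk hq
      rw [this]
      exact mem_insert _ _
    · exact mem_insert_of_mem _ ⟨k, hk, rfl⟩
  have hF : IsTriangulation P (fanComplex H) :=
    ⟨(space_fanComplex H).trans hR.symm, (vertices_fanComplex H).trans hV.symm⟩
  have hNF : N ⊆ {q | q ≠ u 0 ∧ {u 0, q} ∈ (fanComplex H).faces} := by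
    intro q hq
    rcases hq with rfl | ⟨k, hk, rfl⟩
    · refine ⟨fun h => by have := H.u_injective (by omega) (by omega) h; omega,
        (mem_faces_fanComplex H).2 ⟨by simp, n - 1, by omega, ?_⟩⟩
      intro x hx
      simp only [Finset.mem_insert, Finset.mem_singleton] at hx
      rcases hx with rfl | rfl
      · exact mem_fanTriangle.2 (Or.inl (by congr 1; omega))
      · exact mem_fanTriangle.2 (Or.inr (Or.inr (Or.inl (by congr 1; omega))))
    · have hk : k < n := hk
      refine ⟨(H.u_ne_l (by omega) hk).symm,
        (mem_faces_fanComplex H).2 ⟨by simp, k, by omega, ?_⟩⟩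
      intro x hx
      simp only [Finset.mem_insert, Finset.mem_singleton] at hx
      rcases hx with rfl | rfl
      · exact mem_fanTriangle.2 (Or.inl (by congr 1; omega))
      · exact mem_fanTriangle.2 (Or.inr (Or.inl (by congr 1; omega)))
  have hFf : {q | q ≠ u 0 ∧ {u 0, q} ∈ (fanComplex H).faces}.Finite := by
    have : chainPoints n u l ⊆ u '' Iio n ∪ l '' Iio n := by
      rintro x (⟨k, hk, rfl⟩ | ⟨k, hk, rfl⟩)
      · exact Or.inl ⟨k, hk, rfl⟩
      · exact Or.inr ⟨k, hk, rfl⟩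
    refine (((Set.finite_Iio n).image u).union ((Set.finite_Iio n).image l)).subset
      fun q hq => this ?_
    rw [← vertices_fanComplex H]
    exact (fanComplex H).down_closed hq.2 (by simp) (Finset.singleton_nonempty q)
  have hdeg : N.ncard ≤ {q | q ≠ u 0 ∧ {u 0, q} ∈ K.faces}.ncard :=
    (Set.ncard_le_ncard hNF hFf).trans (hK.2 _ hF)
  have hEq := Set.eq_of_subset_of_ncard_le hnbr hdeg hNf
  have hdiag : {u 0, l (n - 1)} ∈ K.faces := by
    have : l (n - 1) ∈ N := mem_insert_of_mem _ ⟨n - 1, by simp; omega, rfl⟩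
    rw [← hEq] at this
    exact this.2
  constructor
  · intro i hi
    obtain ⟨k, hk, hface⟩ := H.exists_apex (fun x hx => H.exists_edge_u_nonneg (hKR ▸ hx)) hKV hi
      (show n - 1 < n by omega) (by
        rw [hKR]
        refine Subset.trans (convexHull_mono ?_) (triangle_upper_subset_fanSpace u l hi)
        intro z
        simp
        tauto)
    by_cases hkn : k + 1 < n
    · refine absurd (K.down_closed hface ?_ (by simp))
        (H.not_mem_faces_of_crossing hdiag (Nat.succ_pos i) hi hkn)
      intro z
      simp
      tauto
    · obtain rfl : k = n - 1 := by omega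
      exact hface
  · intro i hi
    obtain ⟨k, hk, hface⟩ := H.symm.exists_apex (fun x hx => H.exists_edge_l_nonpos (hKR ▸ hx))
      (hKV.trans (chainPoints_comm n u l)) hi (show 0 < n by omega) (by
        rw [hKR]
        refine Subset.trans (convexHull_mono ?_) (triangle_lower_subset_fanSpace u l hi)
        intro z
        simp
        tauto)
    rcases Nat.eq_zero_or_pos k with rfl | h0
    · exact hface
    · refine absurd (K.down_closed hface ?_ (by simp))
        (H.not_mem_faces_of_crossing hdiag h0 hk hi)
      intro z
      simp
      tauto

end ChainPair

/-! ### Triangles at boundary edges under a flip -/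

/-- `K'` arises from `K` by replacing the diagonal `a c` of the quadrilateral `a b c d` by `b d`.
Only what happens to the triangles is recorded, so that this relation is symmetric. -/
structure IsSwap (K K' : SimplicialComplex ℝ Plane) (a b c d : Plane) : Prop where
  crossing : (openSegment ℝ a c ∩ openSegment ℝ b d).Nonempty
  ab : a ≠ b
  ac : a ≠ c
  ad : a ≠ d
  bc : b ≠ c
  bd : b ≠ d
  cd : c ≠ d
  abc : {a, b, c} ∈ K.faces
  acd : {a, c, d} ∈ K.faces
  abd : {a, b, d} ∈ K'.faces
  bcd : {b, c, d} ∈ K'.faces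
  keep : ∀ t ∈ K.faces, t.card = 3 → t ≠ {a, b, c} → t ≠ {a, c, d} → t ∈ K'.faces

theorem triple_rotate (a b c : Plane) : ({b, c, a} : Finset Plane) = {a, b, c} := by
  ext; simp; tauto

theorem triple_reverse (a b c : Plane) : ({c, b, a} : Finset Plane) = {a, b, c} := by
  ext; simp; tauto

theorem quad_reverse (a b c d : Plane) : ({c, b, a, d} : Finset Plane) = {a, b, c, d} := by
  ext; simp only [Finset.mem_insert, Finset.mem_singleton]; tauto

theorem quad_rotate (a b c d : Plane) : ({c, d, a, b} : Finset Plane) = {a, b, c, d} := by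
  ext; simp only [Finset.mem_insert, Finset.mem_singleton]; tauto

theorem IsFlip.exists_isSwap {K K' : SimplicialComplex ℝ Plane} (h : IsFlip K K') :
    ∃ a b c d, IsSwap K K' a b c d ∧ IsSwap K' K b c d a := by
  obtain ⟨a, b, c, d, ⟨hci, hcross⟩, habc, hacd, hK'⟩ := h
  have hinj := hci.injective
  have hab : a ≠ b := fun h => absurd (hinj (a₁ := 0) (a₂ := 1) h) (by decide)
  have hac : a ≠ c := fun h => absurd (hinj (a₁ := 0) (a₂ := 2) h) (by decide)
  have had : a ≠ d := fun h => absurd (hinj (a₁ := 0) (a₂ := 3) h) (by decide)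
  have hbc : b ≠ c := fun h => absurd (hinj (a₁ := 1) (a₂ := 2) h) (by decide)
  have hbd : b ≠ d := fun h => absurd (hinj (a₁ := 1) (a₂ := 3) h) (by decide)
  have hcd : c ≠ d := fun h => absurd (hinj (a₁ := 2) (a₂ := 3) h) (by decide)
  have habd : {a, b, d} ∈ K'.faces := by rw [hK']; exact Or.inr (Or.inl rfl)
  have hbcd : {b, c, d} ∈ K'.faces := by rw [hK']; exact Or.inr (Or.inr (Or.inl rfl))
  have hcard : ∀ {x y : Plane} {t : Finset Plane}, t.card = 3 → t ≠ {x, y} := by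
    rintro x y t ht rfl
    have := Finset.card_le_two (a := x) (b := y)
    omega
  refine ⟨a, b, c, d, ⟨hcross, hab, hac, had, hbc, hbd, hcd, habc, hacd, habd, hbcd, ?_⟩,
    ⟨?_, hbc, hbd, hab.symm, hcd, hac.symm, had.symm, hbcd, ?_, ?_, ?_, ?_⟩⟩
  · intro t ht ht3 h1 h2
    rw [hK']
    refine Or.inl ⟨ht, ?_⟩
    rintro (h | h | h)
    exacts [h1 h, h2 h, hcard ht3 h]
  · rwa [openSegment_symm ℝ c a, inter_comm]
  · rwa [triple_rotate a b d]
  · rwa [triple_rotate a b c]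
  · rwa [triple_rotate a c d]
  · intro t ht ht3 h1 h2
    rw [hK'] at ht
    rcases ht with ht | h | h | h
    · exact ht.1
    · exact absurd (h.trans (triple_rotate a b d).symm) h2
    · exact absurd h h1
    · exact absurd h (hcard ht3)

namespace IsSwap

variable {K K' : SimplicialComplex ℝ Plane} {a b c d : Plane}

theorem reverse (h : IsSwap K K' a b c d) : IsSwap K K' c b a d where
  crossing := by rw [openSegment_symm]; exact h.crossing
  ab := h.bc.symm
  ac := h.ac.symm
  ad := h.cd
  bc := h.ab.symm
  bd := h.bd
  cd := h.ad
  abc := by rw [triple_reverse]; exact h.abc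
  acd := by rw [Finset.insert_comm]; exact h.acd
  abd := by rw [Finset.insert_comm]; exact h.bcd
  bcd := by rw [Finset.insert_comm]; exact h.abd
  keep t ht h3 h1 h2 := h.keep t ht h3 (by rwa [triple_reverse] at h1)
    (by rwa [Finset.insert_comm] at h2)

theorem rotate (h : IsSwap K K' a b c d) : IsSwap K K' c d a b where
  crossing := by rw [openSegment_symm, openSegment_symm ℝ d]; exact h.crossing
  ab := h.cd
  ac := h.ac.symm
  ad := h.bc.symm
  bc := h.ad.symm
  bd := h.bd.symm
  cd := h.ab
  abc := by rw [triple_rotate]; exact h.acd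
  acd := by rw [← triple_rotate]; exact h.abc
  abd := by rw [triple_rotate]; exact h.bcd
  bcd := by rw [← triple_rotate]; exact h.abd
  keep t ht h3 h1 h2 := h.keep t ht h3 (by rwa [← triple_rotate] at h2)
    (by rwa [triple_rotate] at h1)

theorem orient_side (h : IsSwap K K' a b c d) : 0 < orient a b c * orient a b d := by
  obtain ⟨x, hx1, hx2⟩ := h.crossing
  obtain ⟨t, ht0, ht1, e1⟩ := orient_openSegment hx1 a b
  obtain ⟨s, hs0, hs1, e2⟩ := orient_openSegment hx2 a b
  rw [orient_self_outer] at e1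
  rw [orient_self_right] at e2
  have hne := orient_ne_zero_of_mem_faces h.abc h.ab h.ac h.bc
  have e : t * orient a b c = s * orient a b d := by linarith
  have h2 : 0 < t * orient a b c * orient a b c := by
    rw [mul_assoc]; exact mul_pos ht0 (mul_self_pos.2 hne)
  rw [e] at h2
  have h3 : 0 < s * (orient a b c * orient a b d) := by linarith
  exact (mul_pos_iff_of_pos_left hs0).1 h3

theorem orient_diagonal (h : IsSwap K K' a b c d) : orient a c b * orient a c d < 0 := by
  obtain ⟨x, hx1, hx2⟩ := h.crossing
  obtain ⟨s, hs0, hs1, e2⟩ := orient_openSegment hx2 a c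
  rw [mem_openSegment_orient hx1] at e2
  have hne : orient a c b ≠ 0 := by
    rw [orient_swap_right]
    exact neg_ne_zero.2 (orient_ne_zero_of_mem_faces h.abc h.ab h.ac h.bc)
  have h2 : 0 < (1 - s) * (orient a c b * orient a c b) :=
    mul_pos (by linarith) (mul_self_pos.2 hne)
  have h3 : s * (orient a c b * orient a c d) < 0 := by
    have : s * (orient a c b * orient a c d) = -((1 - s) * (orient a c b * orient a c b)) := by
      linear_combination -(orient a c b) * e2
    linarith
  by_contra! hc
  linarith [mul_nonneg hs0.le hc]

/-- A boundary edge of the polygon is not the diagonal of a flip, since the region is not a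
neighbourhood of any boundary point. -/
theorem boundary_edge_ne_diagonal (h : IsSwap K K' a b c d) {m : ℕ} {P : Polygon Plane m}
    (hP : IsSimple P) (hK : K.space = region P) {p q : Plane}
    (he : ∃ e, s(P e, P (finRotate m e)) = s(p, q)) : s(p, q) ≠ s(a, c) := by
  intro hpq
  obtain ⟨e, he⟩ := he
  have hac : segment ℝ (P e) (P (finRotate m e)) = segment ℝ a c := by
    rcases Sym2.eq_iff.1 (he.trans hpq) with ⟨h1, h2⟩ | ⟨h1, h2⟩
    · rw [h1, h2]
    · rw [h1, h2, segment_symm]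
  have hz := midpoint_mem_openSegment a c
  have hzB : midpoint ℝ a c ∈ P.boundary ℝ := by
    refine edgeSet_subset_boundary P e ?_
    rw [edgeSet_eq_segment, hac]
    exact openSegment_subset_segment _ _ _ hz
  have hod := h.orient_diagonal
  have hne : orient a c b ≠ 0 := fun h0 => by rw [h0, zero_mul] at hod; exact lt_irrefl _ hod
  have hsub : ∀ {x y z : Plane}, {x, y, z} ∈ K.faces →
      convexHull ℝ ({x, y, z} : Set Plane) ⊆ region P := by
    intro x y z hxyz
    have := SimplicialComplex.convexHull_subset_space hxyz
    rw [hK] at this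
    simpa using this
  have hnhds := mem_nhds_of_two_triangles (k := orient a c b) (mul_self_pos.2 hne) hod hz
    (hsub (by rw [Finset.pair_comm]; exact h.abc)) (hsub h.acd)
  obtain ⟨y, hy1, hy2⟩ := mem_closure_iff_nhds.1
    (hP.boundary_subset_closure_compl_region hzB) _ hnhds
  exact hy2 hy1

/-- A triangle at an edge `p q` that is destroyed by a flip is replaced by another triangle on the
same side of this edge. -/
theorem exists_new_apex (h : IsSwap K K' a b c d) {p q w : Plane} {k : ℝ}
    (hw : 0 < k * orient p q w) (hface : {p, q, w} ∈ K.faces) (hdiag : s(p, q) ≠ s(a, c)) :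
    ∃ w', {p, q, w'} ∈ K'.faces ∧ 0 < k * orient p q w' ∧
      (w' = w ∨ ({a, b, c, d} : Finset Plane) = {p, q, w, w'} ∧
        ∃ r, (r = p ∨ r = q) ∧ {r, w, w'} ∈ K.faces) := by
  have hpq : p ≠ q := by rintro rfl; simp at hw
  have hpw : p ≠ w := by rintro rfl; simp at hw
  have hqw : q ≠ w := by rintro rfl; simp at hw
  -- it suffices to treat the destroyed triangle `a b c`
  have main : ∀ a b c d : Plane, IsSwap K K' a b c d → s(p, q) ≠ s(a, c) →
      ({p, q, w} : Finset Plane) = {a, b, c} →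
      ∃ w', {p, q, w'} ∈ K'.faces ∧ 0 < k * orient p q w' ∧
        ({a, b, c, d} : Finset Plane) = {p, q, w, w'} ∧
          ∃ r, (r = p ∨ r = q) ∧ {r, w, w'} ∈ K.faces := by
    -- and the edge `a b` of it
    have core : ∀ a b c d : Plane, IsSwap K K' a b c d →
        (p = a ∧ q = b ∨ p = b ∧ q = a) → w = c →
        ∃ w', {p, q, w'} ∈ K'.faces ∧ 0 < k * orient p q w' ∧
          ({a, b, c, d} : Finset Plane) = {p, q, w, w'} ∧
            ∃ r, (r = p ∨ r = q) ∧ {r, w, w'} ∈ K.faces := by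
      rintro a b c d h hpq' rfl
      have hs := h.orient_side
      have sgn : ∀ {x y k : ℝ}, 0 < x * y → 0 < k * x → 0 < k * y := by
        intro x y k hxy hkx
        rcases pos_and_pos_or_neg_and_neg_of_mul_pos hxy with ⟨hx, hy⟩ | ⟨hx, hy⟩
        · exact mul_pos ((pos_iff_pos_of_mul_pos hkx).2 hx) hy
        · exact mul_pos_of_neg_of_neg (neg_of_mul_pos_left hkx hx.le) hy
      rcases hpq' with ⟨rfl, rfl⟩ | ⟨rfl, rfl⟩
      · exact ⟨d, h.abd, sgn hs hw, rfl, p, Or.inl rfl, h.acd⟩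
      · refine ⟨d, by rw [Finset.insert_comm]; exact h.abd, ?_, Finset.insert_comm _ _ _, q,
          Or.inr rfl, h.acd⟩
        rw [orient_swap_left] at hw ⊢
        have : 0 < (-k) * orient q p d := sgn hs (by linarith)
        linarith
    intro a b c d h hdiag heq
    have hp : p ∈ ({a, b, c} : Finset Plane) := heq ▸ by simp
    have hq : q ∈ ({a, b, c} : Finset Plane) := heq ▸ by simp
    have hw' : w ∈ ({a, b, c} : Finset Plane) := heq ▸ by simp
    simp only [Finset.mem_insert, Finset.mem_singleton] at hp hq hw'
    -- two corners other than `w` are the two remaining ones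
    have two : ∀ {x y z : Plane}, w = z → (p = x ∨ p = y ∨ p = z) → (q = x ∨ q = y ∨ q = z) →
        (p = x ∧ q = y ∨ p = y ∧ q = x) := by
      rintro x y z rfl (rfl | rfl | rfl) (rfl | rfl | rfl)
      all_goals first | exact absurd rfl hpq | exact absurd rfl hpw | exact absurd rfl hqw | simp
    rcases hw' with hwa | hwb | hwc
    · obtain ⟨w', h1, h2, h3, h4⟩ := core c b a d h.reverse
        (two hwa (or_assoc.1 (hp.imp_right Or.symm).symm)
          (or_assoc.1 (hq.imp_right Or.symm).symm)) hwa
      exact ⟨w', h1, h2, by rw [← h3, quad_reverse], h4⟩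
    · exact absurd (Sym2.eq_iff.2 (two hwb (hp.imp_right Or.symm) (hq.imp_right Or.symm))) hdiag
    · exact core a b c d h (two hwc hp hq) hwc
  by_cases h1 : ({p, q, w} : Finset Plane) = {a, b, c}
  · obtain ⟨w', h1, h2, h3, h4⟩ := main a b c d h hdiag h1
    exact ⟨w', h1, h2, Or.inr ⟨h3, h4⟩⟩
  by_cases h2 : ({p, q, w} : Finset Plane) = {a, c, d}
  · obtain ⟨w', h1, h2, h3, h4⟩ := main c d a b h.rotate (by rwa [Sym2.eq_swap (a := c)])
      (by rw [h2, ← triple_rotate])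
    exact ⟨w', h1, h2, Or.inr ⟨by rw [← h3, quad_rotate], h4⟩⟩
  · exact ⟨w, h.keep _ hface (Finset.card_eq_three.2 ⟨p, q, w, hpq, hpw, hqw, rfl⟩) h1 h2, hw,
      Or.inl rfl⟩

end IsSwap

/-! ### The potential of a triangulation -/

/-- The middle one of three points of a chain lies in the triangle of the other two and any point of
the other chain. -/
theorem ChainPair.reflex_mem_convexHull {n : ℕ} {σ : ℝ} {u l : ℕ → Plane}
    (H : ChainPair n σ u l) {a b c k : ℕ} (hab : a < b) (hbc : b < c) (hc : c < n) (hk : k < n) :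
    u b ∈ convexHull ℝ ({u a, u c, l k} : Set Plane) := by
  rw [mem_triangle_iff (H.uul a c k (hab.trans hbc) hc hk)]
  have h1 := H.uuu a b c hab hbc hc
  have h2 := H.uul b c k hbc hc hk
  have h3 := H.uul a b k hab (hbc.trans hc) hk
  refine ⟨?_, ?_, ?_⟩
  · rw [orient_swap_right]; linarith
  · rw [← orient_rotate (u c) (l k) (u b), ← orient_rotate (l k) (u b) (u c)]; exact h2.le
  · rw [← orient_rotate (l k) (u a) (u b)]; exact h3.le

/-- The value of the point with index `k` of the chain opposite to an edge of the upper chain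
(`true`) or of the lower chain (`false`). -/
def chainValue (s : Bool) (k : ℕ) : ℕ := if s then min k 4 else 4 - min k 4

theorem chainValue_le (s : Bool) (k : ℕ) : chainValue s k ≤ 4 := by
  unfold chainValue; split <;> omega

theorem chainValue_le_succ {s : Bool} {j k : ℕ} (h : j ≤ k + 1) (h' : k ≤ j + 1) :
    chainValue s j ≤ chainValue s k + 1 := by
  unfold chainValue; split <;> omega

/-- The value of a point `w` as the apex of a triangle at an edge of the chain `c s`: it depends on
the index of `w` in the opposite chain (which is unique, so the choice does not matter), and is `2`
if `w` is not on that chain. -/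
noncomputable def apexValue (n : ℕ) (c : Bool → ℕ → Plane) (s : Bool) (w : Plane) : ℕ :=
  if h : ∃ k < n, w = c (!s) k then chainValue s h.choose else 2

/-- The edges of both chains: `(s, i)` stands for the edge from `c s i` to `c s (i + 1)`. -/
def chainEdges (n : ℕ) : Finset (Bool × ℕ) := Finset.univ ×ˢ Finset.range (n - 1)

theorem mem_chainEdges {n : ℕ} {e : Bool × ℕ} : e ∈ chainEdges n ↔ e.2 + 1 < n := by
  simp only [chainEdges, Finset.mem_product, Finset.mem_univ, true_and, Finset.mem_range]
  omega

/-- `A` assigns to every edge of the chains the apex of a triangle of `K` on the inner side of this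
edge. -/
def IsApexMap (n : ℕ) (σ : Bool → ℝ) (c : Bool → ℕ → Plane) (K : SimplicialComplex ℝ Plane)
    (A : Bool × ℕ → Plane) : Prop :=
  ∀ e ∈ chainEdges n, {c e.1 e.2, c e.1 (e.2 + 1), A e} ∈ K.faces ∧
    0 < σ e.1 * orient (c e.1 e.2) (c e.1 (e.2 + 1)) (A e)

section Potential

variable {n : ℕ} {σ : Bool → ℝ} {c : Bool → ℕ → Plane}

theorem apexValue_chain (H : ∀ s, ChainPair n (σ s) (c s) (c !s)) {s : Bool} {k : ℕ} (hk : k < n) :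
    apexValue n c s (c (!s) k) = chainValue s k := by
  have h : ∃ j < n, c (!s) k = c (!s) j := ⟨k, hk, rfl⟩
  rw [apexValue, dif_pos h]
  congr 1
  exact ((H s).symm.u_injective hk h.choose_spec.1 h.choose_spec.2).symm

theorem apexValue_le (s : Bool) (w : Plane) : apexValue n c s w ≤ 4 := by
  unfold apexValue
  split
  · exact chainValue_le _ _
  · omega

theorem apexValue_other {s : Bool} {w : Plane} (h : ¬∃ k < n, w = c (!s) k) :
    apexValue n c s w = 2 := dif_neg h

/-- The apex of a triangle on the inner side of a chain edge is not on the same chain. -/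
theorem ne_of_orient_pos (H : ∀ s, ChainPair n (σ s) (c s) (c !s)) {s : Bool} {i k : ℕ}
    (hi : i + 1 < n) (hk : k < n) {w : Plane}
    (hw : 0 < σ s * orient (c s i) (c s (i + 1)) w) : c s k ≠ w := by
  rintro rfl
  exact absurd hw (not_lt.2 ((H s).edge_u_nonpos hi hk))

/-- Two points of a chain that form a triangle with a point of the other chain are consecutive, as
the triangle contains the points in between. -/
theorem index_le_succ (H : ∀ s, ChainPair n (σ s) (c s) (c !s)) {K : SimplicialComplex ℝ Plane}
    (hV : ∀ s, ∀ k < n, c s k ∈ K.vertices) {s : Bool} {i j k : ℕ} (hi : i < n) (hj : j < n)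
    (hk : k < n) (h : {c s i, c (!s) j, c (!s) k} ∈ K.faces) : j ≤ k + 1 := by
  by_contra! hlt
  have hmem := (H s).symm.reflex_mem_convexHull (Nat.lt_succ_self k) hlt hj hi
  have hmem' : c (!s) (k + 1) ∈ convexHull ℝ
      (({c s i, c (!s) j, c (!s) k} : Finset Plane) : Set Plane) := by
    refine convexHull_mono ?_ hmem
    intro z
    simp
    tauto
  rw [SimplicialComplex.vertex_mem_convexHull_iff (hV _ _ (by omega)) h] at hmem'
  simp only [Finset.mem_insert, Finset.mem_singleton] at hmem'
  rcases hmem' with h | h | h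
  · exact (H s).u_ne_l hi (by omega) h.symm
  · have := (H s).symm.u_injective (by omega) hj h
    omega
  · have := (H s).symm.u_injective (by omega) hk h
    omega

/-- A flip decreases the total value of the apices of all chain edges by at most `2`. Either it
changes the apex of one chain edge only; or its quadrilateral is spanned by one edge of each chain,
and then both apices move to a neighbouring point of the opposite chain. -/
theorem IsSwap.exists_isApexMap (H : ∀ s, ChainPair n (σ s) (c s) (c !s))
    {K K' : SimplicialComplex ℝ Plane} {x₁ x₂ x₃ x₄ : Plane} (h : IsSwap K K' x₁ x₂ x₃ x₄)
    (hV : ∀ s, ∀ k < n, c s k ∈ K.vertices)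
    (hdiag : ∀ e ∈ chainEdges n, s(c e.1 e.2, c e.1 (e.2 + 1)) ≠ s(x₁, x₃))
    {A : Bool × ℕ → Plane} (hA : IsApexMap n σ c K A) :
    ∃ A', IsApexMap n σ c K' A' ∧
      ∑ e ∈ chainEdges n, apexValue n c e.1 (A e) ≤
        ∑ e ∈ chainEdges n, apexValue n c e.1 (A' e) + 2 := by
  have hex : ∀ e, ∃ w', e ∈ chainEdges n →
      {c e.1 e.2, c e.1 (e.2 + 1), w'} ∈ K'.faces ∧
      0 < σ e.1 * orient (c e.1 e.2) (c e.1 (e.2 + 1)) w' ∧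
      (w' = A e ∨ ({x₁, x₂, x₃, x₄} : Finset Plane) = {c e.1 e.2, c e.1 (e.2 + 1), A e, w'} ∧
        ∃ r, (r = c e.1 e.2 ∨ r = c e.1 (e.2 + 1)) ∧ {r, A e, w'} ∈ K.faces) := by
    intro e
    by_cases he : e ∈ chainEdges n
    · obtain ⟨w', hw'⟩ := h.exists_new_apex (hA e he).2 (hA e he).1 (hdiag e he)
      exact ⟨w', fun _ => hw'⟩
    · exact ⟨0, fun h => absurd h he⟩
  choose A' hA' using hex
  refine ⟨A', fun e he => ⟨(hA' e he).1, (hA' e he).2.1⟩, ?_⟩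
  set S := (chainEdges n).filter fun e => A' e ≠ A e with hS
  have hSA : ∀ e ∈ S, ({x₁, x₂, x₃, x₄} : Finset Plane) =
        {c e.1 e.2, c e.1 (e.2 + 1), A e, A' e} ∧
        ∃ r, (r = c e.1 e.2 ∨ r = c e.1 (e.2 + 1)) ∧ {r, A e, A' e} ∈ K.faces := by
    intro e he
    obtain ⟨he1, he2⟩ := Finset.mem_filter.1 he
    exact (hA' e he1).2.2.resolve_left he2
  have hSE : ∀ e ∈ S, e ∈ chainEdges n := fun e he => (Finset.mem_filter.1 he).1
  -- a change within the opposite chain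
  have hinner : ∀ e ∈ S, ∀ j < n, ∀ k < n, A e = c (!e.1) j → A' e = c (!e.1) k →
      apexValue n c e.1 (A e) ≤ apexValue n c e.1 (A' e) + 1 := by
    intro e he j hj k hk h1 h2
    have hen := mem_chainEdges.1 (hSE e he)
    obtain ⟨-, r, hr, hface⟩ := hSA e he
    rw [h1, h2, apexValue_chain H hj, apexValue_chain H hk]
    rw [h1, h2] at hface
    obtain ⟨i, hi, rfl⟩ : ∃ i < n, r = c e.1 i := by
      rcases hr with rfl | rfl
      · exact ⟨_, by omega, rfl⟩
      · exact ⟨_, hen, rfl⟩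
    refine chainValue_le_succ (index_le_succ H hV hi hj hk hface)
      (index_le_succ H hV (s := e.1) hi hk hj ?_)
    rwa [Finset.pair_comm]
  have houter : ∀ e ∈ S, apexValue n c e.1 (A e) ≤ apexValue n c e.1 (A' e) + 2 := by
    intro e he
    by_cases h1 : ∃ k < n, A e = c (!e.1) k
    · by_cases h2 : ∃ k < n, A' e = c (!e.1) k
      · obtain ⟨j, hj, h1⟩ := h1
        obtain ⟨k, hk, h2⟩ := h2
        have := hinner e he j hj k hk h1 h2
        omega
      · rw [apexValue_other h2]
        exact apexValue_le _ _
    · rw [apexValue_other h1]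
      omega
  -- a second changed edge belongs to the opposite chain and joins the old and the new apex
  have hother : ∀ e ∈ S, ∀ f ∈ S, f ≠ e → f.1 = !e.1 ∧
      (c f.1 f.2 = A e ∧ c f.1 (f.2 + 1) = A' e ∨ c f.1 f.2 = A' e ∧ c f.1 (f.2 + 1) = A e) := by
    rintro ⟨s, i⟩ he ⟨t, j⟩ hf hne
    have hi : i + 1 < n := mem_chainEdges.1 (hSE _ he)
    have hj : j + 1 < n := mem_chainEdges.1 (hSE _ hf)
    have heq := (hSA _ he).1.symm.trans (hSA _ hf).1
    have hp : c t j ∈ ({c s i, c s (i + 1), A (s, i), A' (s, i)} : Finset Plane) := by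
      rw [heq]; simp
    have hq : c t (j + 1) ∈ ({c s i, c s (i + 1), A (s, i), A' (s, i)} : Finset Plane) := by
      rw [heq]; simp
    simp only [Finset.mem_insert, Finset.mem_singleton] at hp hq
    have hA1 := (hA _ (hSE _ he)).2
    have hA2 := (hA' _ (hSE _ he)).2.1
    by_cases hts : t = s
    · subst hts
      exfalso
      have inj := fun {a b : ℕ} (ha : a < n) (hb : b < n) (h : c t a = c t b) =>
        (H t).u_injective ha hb h
      have hp1 := ne_of_orient_pos H hi (show j < n by omega) hA1
      have hp2 := ne_of_orient_pos H hi (show j < n by omega) hA2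
      have hq1 := ne_of_orient_pos H hi hj hA1
      have hq2 := ne_of_orient_pos H hi hj hA2
      have hp' : c t j = c t i ∨ c t j = c t (i + 1) := by tauto
      have hq' : c t (j + 1) = c t i ∨ c t (j + 1) = c t (i + 1) := by tauto
      have hj1 : j = i ∨ j = i + 1 := hp'.imp (inj (by omega) (by omega)) (inj (by omega) hi)
      have hj2 : j + 1 = i ∨ j + 1 = i + 1 := hq'.imp (inj hj (by omega)) (inj hj hi)
      exact hne (by rw [show j = i by omega])
    · have ht : t = !s := by revert hts; cases t <;> cases s <;> simp
      subst ht
      refine ⟨rfl, ?_⟩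
      have hp1 := (H s).u_ne_l (show i < n by omega) (show j < n by omega)
      have hp2 := (H s).u_ne_l hi (show j < n by omega)
      have hq1 := (H s).u_ne_l (show i < n by omega) hj
      have hq2 := (H s).u_ne_l hi hj
      have hne' : c (!s) j ≠ c (!s) (j + 1) := fun h => by
        have := (H s).symm.u_injective (by omega) hj h
        omega
      simp only
      grind
  have hcard : S.card ≤ 2 := by
    rcases S.eq_empty_or_nonempty with h0 | ⟨e, he⟩
    · simp [h0]
    have : (S.erase e).card ≤ 1 := by
      rw [Finset.card_le_one]
      rintro ⟨t, j⟩ hf ⟨t', j'⟩ hf'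
      obtain ⟨hfe, hf⟩ := Finset.mem_erase.1 hf
      obtain ⟨hfe', hf'⟩ := Finset.mem_erase.1 hf'
      by_contra hne
      have h1 := (hother e he _ hf hfe).1
      have h2 := (hother e he _ hf' hfe').1
      have h3 := (hother _ hf _ hf' (Ne.symm hne)).1
      simp only at h1 h2 h3
      rw [h1, h2] at h3
      cases h4 : e.1 <;> simp [h4] at h3
    rw [Finset.card_erase_of_mem he] at this
    omega
  set δ : ℕ := if S.card ≤ 1 then 2 else 1 with hδ
  have hpt : ∀ e ∈ chainEdges n, apexValue n c e.1 (A e) ≤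
      apexValue n c e.1 (A' e) + if e ∈ S then δ else 0 := by
    intro e he
    by_cases heS : e ∈ S
    · rw [if_pos heS, hδ]
      by_cases h1 : S.card ≤ 1
      · rw [if_pos h1]
        exact houter e heS
      · rw [if_neg h1]
        obtain ⟨f, hf, hfe⟩ := Finset.exists_mem_ne (by omega : 1 < S.card) e
        have hfn := mem_chainEdges.1 (hSE f hf)
        obtain ⟨hf1, hf2⟩ := hother e heS f hf hfe
        rw [hf1] at hf2
        rcases hf2 with ⟨h2, h3⟩ | ⟨h2, h3⟩
        · exact hinner e heS _ (by omega) _ hfn h2.symm h3.symm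
        · exact hinner e heS _ hfn _ (by omega) h3.symm h2.symm
    · have : A' e = A e := by
        by_contra hne
        exact heS (Finset.mem_filter.2 ⟨he, hne⟩)
      rw [this]
      omega
  have hsum : ∑ e ∈ chainEdges n, (if e ∈ S then δ else 0) ≤ 2 := by
    have : (chainEdges n).filter (fun e => e ∈ S) = S := by
      ext e
      simp only [Finset.mem_filter]
      exact ⟨fun h => h.2, fun h => ⟨hSE e h, h⟩⟩
    rw [← Finset.sum_filter, this, Finset.sum_const, smul_eq_mul, hδ]
    split <;> omega
  calc _ ≤ ∑ e ∈ chainEdges n, (apexValue n c e.1 (A' e) + if e ∈ S then δ else 0) :=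
        Finset.sum_le_sum hpt
    _ ≤ _ := by rw [Finset.sum_add_distrib]; omega

/-- Along a sequence of flips, the total value of the apices drops by at most `2` per flip. -/
theorem exists_isApexMap_of_walk (H : ∀ s, ChainPair n (σ s) (c s) (c !s)) {m : ℕ}
    {P : Polygon Plane m} (hP : IsSimple P)
    (hV : ∀ s, ∀ k < n, c s k ∈ Set.range P.vertices)
    (hB : ∀ e ∈ chainEdges n,
      ∃ k, s(P k, P (finRotate m k)) = s(c e.1 e.2, c e.1 (e.2 + 1)))
    {T T' : Triangulation P} (w : (flipGraph P).Walk T T') {A : Bool × ℕ → Plane}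
    (hA : IsApexMap n σ c T.1 A) :
    ∃ A', IsApexMap n σ c T'.1 A' ∧
      ∑ e ∈ chainEdges n, apexValue n c e.1 (A e) ≤
        ∑ e ∈ chainEdges n, apexValue n c e.1 (A' e) + 2 * w.length := by
  induction w generalizing A with
  | nil => exact ⟨A, hA, by simp⟩
  | @cons T₁ T₂ T₃ hadj w ih =>
    obtain ⟨x₁, x₂, x₃, x₄, hswap⟩ : ∃ x₁ x₂ x₃ x₄, IsSwap T₁.1 T₂.1 x₁ x₂ x₃ x₄ := by
      rcases ((SimpleGraph.fromRel_adj _ _ _).1 hadj).2 with h | h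
      · obtain ⟨a, b, c, d, h, -⟩ := h.exists_isSwap
        exact ⟨a, b, c, d, h⟩
      · obtain ⟨a, b, c, d, -, h⟩ := h.exists_isSwap
        exact ⟨b, c, d, a, h⟩
    obtain ⟨A₂, hA₂, h₂⟩ := hswap.exists_isApexMap H
      (fun s k hk => T₁.2.vertices_eq ▸ hV s k hk)
      (fun e he => hswap.boundary_edge_ne_diagonal hP T₁.2.space_eq (hB e he)) hA
    obtain ⟨A₃, hA₃, h₃⟩ := ih hA₂
    refine ⟨A₃, hA₃, ?_⟩
    rw [SimpleGraph.Walk.length_cons]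
    omega

end Potential

theorem IsBoundaryPath.mem_range {n m : ℕ} {c : Fin n → Plane} {P : Polygon Plane m}
    (h : IsBoundaryPath c P) (hn : 2 ≤ n) {k : ℕ} (hk : k < n) :
    chainExt c k ∈ Set.range P.vertices := by
  have key : ∀ i (hi : i + 1 < n), chainExt c i ∈ Set.range P.vertices ∧
      chainExt c (i + 1) ∈ Set.range P.vertices := by
    intro i hi
    obtain ⟨e, he⟩ := h ⟨i, by omega⟩ ⟨i + 1, hi⟩ rfl
    rw [← chainExt_of_lt c, ← chainExt_of_lt c] at he
    rcases Sym2.eq_iff.1 he with ⟨h1, h2⟩ | ⟨h1, h2⟩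
    · exact ⟨⟨_, h1⟩, ⟨_, h2⟩⟩
    · exact ⟨⟨_, h2⟩, ⟨_, h1⟩⟩
  by_cases hk' : k + 1 < n
  · exact (key k hk').1
  · obtain ⟨i, rfl⟩ : ∃ i, k = i + 1 := ⟨k - 1, by omega⟩
    exact (key i hk).2

end PolyFlip

theorem mainTheorem4 {n m : ℕ} (hn : 5 ≤ n)
    (u l : Fin n → PolyFlip.Plane) (hD : PolyFlip.IsDoubleChain u l)
    (P : Polygon PolyFlip.Plane m) (hP : PolyFlip.IsSimple P)
    (hsub : PolyFlip.region (PolyFlip.doubleChainPolygon u l) ⊆ PolyFlip.region P)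
    (hl : PolyFlip.IsBoundaryPath l P) (hu : PolyFlip.IsBoundaryPath u P)
    (Tu Tl : Geometry.SimplicialComplex ℝ PolyFlip.Plane)
    (hTu : PolyFlip.IsMaxDegreeTriangulation (PolyFlip.doubleChainPolygon u l)
      (u ⟨0, by omega⟩) Tu)
    (hTl : PolyFlip.IsMaxDegreeTriangulation (PolyFlip.doubleChainPolygon u l)
      (l ⟨0, by omega⟩) Tl)
    (T₁ T₂ : PolyFlip.Triangulation P)
    (h₁ : Tu.faces ⊆ T₁.1.faces) (h₂ : Tl.faces ⊆ T₂.1.faces) :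
    ((4 * n - 4 : ℕ) : ℕ∞) ≤ PolyFlip.flipDist T₁ T₂ := by
  open PolyFlip in
  obtain ⟨σ, H⟩ := hD.exists_chainPair (by omega)
  -- the region of the double chain, from the point of view of either chain
  have hbd := boundary_doubleChainPolygon (by omega) u l
  have hrange : Set.range (doubleChainPolygon u l).vertices =
      chainPoints n (chainExt u) (chainExt l) := range_doubleChainPolygon u l
  have hRu := H.region_eq_fanSpace hD.simple hbd ⟨⟨0, by omega⟩, by
    rw [finRotate_mk _ (by omega), doubleChainPolygon_lower u l (by omega),
      doubleChainPolygon_lower u l (by omega)]⟩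
  have hRl := H.symm.region_eq_fanSpace hD.simple (hbd.trans (chainBoundary_comm _ _ _))
    ⟨⟨n + (n - 1 - 1), by omega⟩, by
      rw [finRotate_mk _ (by omega), doubleChainPolygon_upper u l (by omega), Sym2.eq_swap,
        ← doubleChainPolygon_upper u l (k := 0) (by omega) (by omega)]
      congr 3
      omega⟩
  rw [← chainExt_of_lt u] at hTu
  rw [← chainExt_of_lt l] at hTl
  obtain ⟨hu1, hl1⟩ := H.faces_of_isMaxDegree hRu hrange hTu
  obtain ⟨hl2, hu2⟩ := H.symm.faces_of_isMaxDegree hRl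
    (hrange.trans (chainPoints_comm _ _ _)) hTl
  -- both chains and their signs, indexed by `true` for `u` and `false` for `l`
  let c : Bool → ℕ → Plane := fun s => if s then chainExt u else chainExt l
  let τ : Bool → ℝ := fun s => if s then σ else -σ
  have Hc : ∀ s, ChainPair n (τ s) (c s) (c !s) := by
    intro s
    cases s
    · exact H.symm
    · exact H
  have hV : ∀ s, ∀ k < n, c s k ∈ Set.range P.vertices := by
    intro s k hk
    cases s
    · exact hl.mem_range (by omega) hk
    · exact hu.mem_range (by omega) hk
  have hB : ∀ e ∈ chainEdges n,
      ∃ k, s(P k, P (finRotate m k)) = s(c e.1 e.2, c e.1 (e.2 + 1)) := by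
    rintro ⟨s, i⟩ he
    have hi : i + 1 < n := mem_chainEdges.1 he
    cases s
    · obtain ⟨k, hk⟩ := hl ⟨i, by omega⟩ ⟨i + 1, hi⟩ rfl
      rw [← chainExt_of_lt l, ← chainExt_of_lt l] at hk
      exact ⟨k, hk⟩
    · obtain ⟨k, hk⟩ := hu ⟨i, by omega⟩ ⟨i + 1, hi⟩ rfl
      rw [← chainExt_of_lt u, ← chainExt_of_lt u] at hk
      exact ⟨k, hk⟩
  -- the apices in the upper extreme triangulation all have value `4`, those in the lower one `0`
  let A₁ : Bool × ℕ → Plane := fun e => if e.1 then chainExt l (n - 1) else chainExt u 0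
  have hA₁ : IsApexMap n τ c T₁.1 A₁ := by
    rintro ⟨s, i⟩ he
    have hi : i + 1 < n := mem_chainEdges.1 he
    cases s
    · exact ⟨h₁ (hl1 i hi), (Hc false).uul i (i + 1) 0 (by omega) hi (by omega)⟩
    · exact ⟨h₁ (hu1 i hi), (Hc true).uul i (i + 1) (n - 1) (by omega) hi (by omega)⟩
  have hval₁ : ∀ e ∈ chainEdges n, apexValue n c e.1 (A₁ e) = 4 := by
    rintro ⟨s, i⟩ he
    cases s
    · exact (apexValue_chain Hc (s := false) (show 0 < n by omega)).trans (by simp [chainValue])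
    · exact (apexValue_chain Hc (s := true) (show n - 1 < n by omega)).trans
        (by simp [chainValue]; omega)
  have hcard : (chainEdges n).card = 2 * (n - 1) := by simp [chainEdges]
  refine le_iInf fun w => ?_
  obtain ⟨A₂, hA₂, hle⟩ := exists_isApexMap_of_walk Hc hP hV hB w hA₁
  have hval₂ : ∀ e ∈ chainEdges n, apexValue n c e.1 (A₂ e) = 0 := by
    rintro ⟨s, i⟩ he
    have hi : i + 1 < n := mem_chainEdges.1 he
    obtain ⟨hf, ho⟩ := hA₂ _ he
    cases s
    · have : A₂ (false, i) = c (!false) (n - 1) :=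
        apex_unique hf (h₂ (hl2 i hi)) ho
          ((Hc false).uul i (i + 1) (n - 1) (by omega) hi (by omega))
      simp only [this]
      exact (apexValue_chain Hc (s := false) (show n - 1 < n by omega)).trans
        (by simp [chainValue]; omega)
    · have : A₂ (true, i) = c (!true) 0 :=
        apex_unique hf (h₂ (hu2 i hi)) ho
          ((Hc true).uul i (i + 1) 0 (by omega) hi (by omega))
      simp only [this]
      exact (apexValue_chain Hc (s := true) (show 0 < n by omega)).trans (by simp [chainValue])
  rw [Finset.sum_congr rfl hval₁, Finset.sum_congr rfl hval₂, Finset.sum_const, hcard] at hle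
  simp only [Finset.sum_const_zero, smul_eq_mul] at hle
  exact_mod_cast (by omega : 4 * n - 4 ≤ w.length)
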